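/- Let $p$ be a prime, $k$ an algebraically closed field of characteristic $p$, and let $a\ge 1$, $b\ge 0$ be integers with $a+b=dp+r$, $a=up+a_0$, $b=vp+b_0$, where $d,u,v\ge 0$ are integers, $0\le r,a_0,b_0\le p-1$ and $r\ne 0$. Let $S^\mu$ be the Specht module over $k$ of the symmetric group $\mathfrak{S}_{a+b}$ for the hook partition $\mu=(a,1^b)$, that is, the span of the $\mu$-polytabloids. For $1\le s\le d$ let $E_s\le\mathfrak{S}_{a+b}$ be the elementary abelian $p$-subgroup generated by the $p$-cycles $g_i=((i-1)p+1,(i-1)p+2,\ldots,ip)$, $1\le i\le s$. For a finitely generated $kE_s$-module $M$ and $\alpha\in k^s$ put $u_\alpha=1+\sum_{i=1}^s\alpha_i(g_i-1)\in kE_s$. The generic Jordan type of $M$ is the Jordan type (the multiset of the sizes of the Jordan blocks) of the nilpotent operator $u_\alpha-1$ on $M$ for generic $\alpha$, i.e. for all $\alpha$ in some nonempty Zariski-open subset of $k^s$. The stable generic Jordan type of $M$ is obtained from it by removing all blocks of size $p$. Then, for every $1\le s\le d$, the stable generic Jordan type of the restriction $S^\mu{\downarrow_{E_s}}$ is $\left(1^{N(\mu;s)}\right)$,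 i.e. it consists of $N(\mu;s)$ blocks of size $1$, where $$N(\mu;s)=\sum_{(c_1,c_2)\in\Lambda(u,v;s)}\binom{s}{c_2}\binom{(d-s)p+r-1}{b-c_2p}$$ and $\Lambda(u,v;s)$ is the set of pairs $(c_1,c_2)$ of integers with $0\le c_1\le u$, $0\le c_2\le v$ and $c_1+c_2=s$ (an empty sum is $0$). -/

import Mathlib

/-! ### Tableaux, tabloids and Specht modules -/

/-- A `μ`-tableau with entries in `Fin n` (the letters `1, …, n`, numbered from `0`):
a bijection between the nodes of the Young diagram and the letters.
(There are none unless `n` is the number of nodes of `μ`.) -/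
structure YTableau (μ : YoungDiagram) (n : ℕ) where
  toEquiv : μ.cells ≃ Fin n

namespace YTableau

variable {μ : YoungDiagram} {n : ℕ}

/-- The index of the row of `t` containing the letter `m`. -/
def rowOf (t : YTableau μ n) (m : Fin n) : ℕ := (t.toEquiv.symm m).1.1

/-- The index of the column of `t` containing the letter `m`. -/
def colOf (t : YTableau μ n) (m : Fin n) : ℕ := (t.toEquiv.symm m).1.2

/-- The symmetric group acts on tableaux by permuting the entries. -/
instance : MulAction (Equiv.Perm (Fin n)) (YTableau μ n) where
  smul σ t := ⟨t.toEquiv.trans σ⟩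
  one_smul _ := rfl
  mul_smul _ _ _ := rfl

theorem rowOf_smul (σ : Equiv.Perm (Fin n)) (t : YTableau μ n) (m : Fin n) :
    (σ • t).rowOf m = t.rowOf (σ⁻¹ m) := rfl

theorem colOf_smul (σ : Equiv.Perm (Fin n)) (t : YTableau μ n) (m : Fin n) :
    (σ • t).colOf m = t.colOf (σ⁻¹ m) := rfl

/-- The row stabilizer `R_t`. -/
def rowStabilizer (t : YTableau μ n) : Subgroup (Equiv.Perm (Fin n)) where
  carrier := {σ | ∀ m, t.rowOf (σ m) = t.rowOf m}
  one_mem' := fun _ => rfl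
  mul_mem' := fun {σ τ} hσ hτ m => (hσ (τ m)).trans (hτ m)
  inv_mem' := fun {σ} hσ m => by
    have h := hσ (σ⁻¹ m)
    have e : σ (σ⁻¹ m) = m := Equiv.apply_symm_apply σ m
    rw [e] at h
    exact h.symm

/-- The column stabilizer `C_t`. -/
def colStabilizer (t : YTableau μ n) : Subgroup (Equiv.Perm (Fin n)) where
  carrier := {σ | ∀ m, t.colOf (σ m) = t.colOf m}
  one_mem' := fun _ => rfl
  mul_mem' := fun {σ τ} hσ hτ m => (hσ (τ m)).trans (hτ m)
  inv_mem' := fun {σ} hσ m => by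
    have h := hσ (σ⁻¹ m)
    have e : σ (σ⁻¹ m) = m := Equiv.apply_symm_apply σ m
    rw [e] at h
    exact h.symm

theorem mem_rowStabilizer {t : YTableau μ n} {σ : Equiv.Perm (Fin n)} :
    σ ∈ t.rowStabilizer ↔ ∀ m, t.rowOf (σ m) = t.rowOf m := Iff.rfl

theorem mem_colStabilizer {t : YTableau μ n} {σ : Equiv.Perm (Fin n)} :
    σ ∈ t.colStabilizer ↔ ∀ m, t.colOf (σ m) = t.colOf m := Iff.rfl

theorem conj_mem_rowStabilizer {t : YTableau μ n} {σ : Equiv.Perm (Fin n)}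
    (hσ : σ ∈ t.rowStabilizer) (τ : Equiv.Perm (Fin n)) :
    τ * σ * τ⁻¹ ∈ (τ • t).rowStabilizer := by
  intro m
  simpa [rowOf_smul] using hσ (τ⁻¹ m)

theorem conj_mem_colStabilizer {t : YTableau μ n} {σ : Equiv.Perm (Fin n)}
    (hσ : σ ∈ t.colStabilizer) (τ : Equiv.Perm (Fin n)) :
    τ * σ * τ⁻¹ ∈ (τ • t).colStabilizer := by
  intro m
  simpa [colOf_smul] using hσ (τ⁻¹ m)

/-- Row equivalence: `t ∼ t'` if and only if `t' = σ t` for some `σ ∈ R_t`. -/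
instance rowSetoid (μ : YoungDiagram) (n : ℕ) : Setoid (YTableau μ n) where
  r t t' := ∃ σ ∈ t.rowStabilizer, t' = σ • t
  iseqv :=
    { refl := fun t => ⟨1, one_mem _, (one_smul _ t).symm⟩
      symm := by
        rintro t _ ⟨σ, hσ, rfl⟩
        refine ⟨σ⁻¹, ?_, (inv_smul_smul σ t).symm⟩
        simpa using conj_mem_rowStabilizer (inv_mem hσ) σ
      trans := by
        rintro t _ _ ⟨σ, hσ, rfl⟩ ⟨τ, hτ, rfl⟩
        refine ⟨τ * σ, ?_, (mul_smul τ σ t).symm⟩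
        have h := conj_mem_rowStabilizer hτ σ⁻¹
        rw [inv_smul_smul, inv_inv] at h
        have h2 := mul_mem hσ h
        simpa [mul_assoc] using h2 }

end YTableau

/-- A `μ`-tabloid: a row-equivalence class of `μ`-tableaux. -/
def YTabloid (μ : YoungDiagram) (n : ℕ) : Type := Quotient (YTableau.rowSetoid μ n)

namespace YTabloid

variable {μ : YoungDiagram} {n : ℕ}

/-- The tabloid `{t}` of a tableau `t`. -/
def mk (t : YTableau μ n) : YTabloid μ n := Quotient.mk _ t

/-- The symmetric group acts on tabloids by `σ {t} = {σ t}`. -/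
instance : MulAction (Equiv.Perm (Fin n)) (YTabloid μ n) where
  smul σ := Quotient.map (fun t => σ • t) (by
    rintro t _ ⟨τ, hτ, rfl⟩
    exact ⟨σ * τ * σ⁻¹, YTableau.conj_mem_rowStabilizer hτ σ, by simp [mul_smul]⟩)
  one_smul := by rintro ⟨t⟩; rfl
  mul_smul := by rintro σ τ ⟨t⟩; rfl

theorem smul_mk (σ : Equiv.Perm (Fin n)) (t : YTableau μ n) : σ • mk t = mk (σ • t) := rfl

end YTabloid

section Specht

open scoped Classical in
/-- The polytabloid `e_t = ∑_{σ ∈ C_t} sgn(σ) {σ t}`, in the permutation module on tabloids. -/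
noncomputable def polytabloid (k : Type*) [Field k] {μ : YoungDiagram} {n : ℕ}
    (t : YTableau μ n) : MonoidAlgebra k (YTabloid μ n) :=
  ∑ σ : Equiv.Perm (Fin n) with σ ∈ t.colStabilizer,
    MonoidAlgebra.single (YTabloid.mk (σ • t)) ((Equiv.Perm.sign σ : ℤ) : k)

theorem ofMulAction_polytabloid (k : Type*) [Field k] {μ : YoungDiagram} {n : ℕ}
    (τ : Equiv.Perm (Fin n)) (t : YTableau μ n) :
    Representation.ofMulAction k (Equiv.Perm (Fin n)) (YTabloid μ n) τ (polytabloid k t) =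
      polytabloid k (τ • t) := by
  classical
  unfold polytabloid
  rw [map_sum]
  refine Finset.sum_bij (fun σ _ => τ * σ * τ⁻¹) ?_ ?_ ?_ ?_
  · intro σ hσ
    simp only [Finset.mem_filter, Finset.mem_univ, true_and] at hσ ⊢
    exact YTableau.conj_mem_colStabilizer hσ τ
  · intro σ _ σ' _ h
    simpa using h
  · intro σ hσ
    simp only [Finset.mem_filter, Finset.mem_univ, true_and] at hσ
    refine ⟨τ⁻¹ * σ * τ, ?_, by group⟩
    simp only [Finset.mem_filter, Finset.mem_univ, true_and]
    have h := YTableau.conj_mem_colStabilizer hσ τ⁻¹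
    rwa [inv_smul_smul, inv_inv] at h
  · intro σ _
    rw [Representation.ofMulAction_single, YTabloid.smul_mk]
    have h : Equiv.Perm.sign (τ * σ * τ⁻¹) = Equiv.Perm.sign σ := by
      rw [map_mul, map_mul, map_inv, mul_right_comm, mul_inv_cancel, one_mul]
    rw [h]
    simp [mul_smul]

/-- The Specht module `S^μ` over `k`: the span of the `μ`-polytabloids, as a subrepresentation
of the permutation representation of the symmetric group on `μ`-tabloids. -/
noncomputable def spechtSubrep (k : Type*) [Field k] (μ : YoungDiagram) (n : ℕ) :
    Subrepresentation (Representation.ofMulAction k (Equiv.Perm (Fin n)) (YTabloid μ n)) where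
  toSubmodule := Submodule.span k (Set.range fun t : YTableau μ n => polytabloid k t)
  apply_mem_toSubmodule := by
    intro τ v hv
    induction hv using Submodule.span_induction with
    | mem x hx =>
      obtain ⟨t, rfl⟩ := hx
      dsimp only
      rw [ofMulAction_polytabloid]
      exact Submodule.subset_span ⟨τ • t, rfl⟩
    | zero => rw [map_zero]; exact zero_mem _
    | add x y _ _ hx hy => rw [map_add]; exact add_mem hx hy
    | smul c x _ hx => rw [map_smul]; exact Submodule.smul_mem _ c hx

/-- The underlying vector space of the Specht module `S^μ`. -/
abbrev SpechtModule (k : Type*) [Field k] (μ : YoungDiagram) (n : ℕ) : Type _ :=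
  ↥(spechtSubrep k μ n).toSubmodule

/-- The Specht module `S^μ` as a representation of the symmetric group on `n` letters. -/
noncomputable def spechtRep (k : Type*) [Field k] (μ : YoungDiagram) (n : ℕ) :
    Representation k (Equiv.Perm (Fin n)) (SpechtModule k μ n) :=
  (spechtSubrep k μ n).toRepresentation

end Specht

/-- The Young diagram of the hook partition `(a, 1^b)`, with `a ≥ 1`. -/
def hookDiagram (a b : ℕ) (ha : 1 ≤ a) : YoungDiagram :=
  YoungDiagram.ofRowLens (a :: List.replicate b 1) (by
    refine List.Pairwise.sortedGE (List.pairwise_cons.2 ⟨fun x hx => ?_, ?_⟩)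
    · rw [List.eq_of_mem_replicate hx]; exact ha
    · exact List.pairwise_replicate.2 (Or.inr le_rfl))

/-! ### The elementary abelian subgroups -/

/-- The cycle `(ip+1, ip+2, …, (i+1)p)` of the symmetric group on `n` letters. In `Fin n`, letters
are numbered from `0`, so that the cycle runs through the `m` with `ip ≤ m < (i+1)p` in increasing
order. It is only used for `(i+1)p ≤ n`. -/
def blockCycle (p n i : ℕ) : Equiv.Perm (Fin n) :=
  ((List.finRange n).filter fun m => i * p ≤ m.val ∧ m.val < (i + 1) * p).formPerm

/-- The subgroup `E_s` generated by the first `s` of these `p`-cycles. -/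
def elemAbelian (p n s : ℕ) : Subgroup (Equiv.Perm (Fin n)) :=
  Subgroup.closure (Set.range fun i : Fin s => blockCycle p n i)

/-- The generators `g_1, …, g_s` of `E_s`, as elements of `E_s`. -/
def elemAbelianGen (p n s : ℕ) (i : Fin s) : elemAbelian p n s :=
  ⟨blockCycle p n i, Subgroup.subset_closure ⟨i, rfl⟩⟩

/-! ### Generic Jordan types -/

/-- `T` is a nilpotent operator with Jordan type `τ`, the multiset of the sizes of its Jordan
blocks: there is a basis, made of strings `b_{j,0} ↦ b_{j,1} ↦ ⋯ ↦ b_{j,ℓ_j-1} ↦ 0`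
whose lengths `ℓ_j ≥ 1` form the multiset `τ`. -/
def HasJordanType {k V : Type*} [Field k] [AddCommGroup V] [Module k V]
    (T : Module.End k V) (τ : Multiset ℕ) : Prop :=
  ∃ (m : ℕ) (ℓ : Fin m → ℕ) (b : Module.Basis (Σ j : Fin m, Fin (ℓ j)) k V),
    (∀ j, 1 ≤ ℓ j) ∧ Finset.univ.val.map ℓ = τ ∧
    ∀ (j : Fin m) (i : Fin (ℓ j)),
      T (b ⟨j, i⟩) = if h : i.val + 1 < ℓ j then b ⟨j, ⟨i.val + 1, h⟩⟩ else 0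

/-- The element `u_α = 1 + ∑ α_i (g_i - 1)` of the group algebra `kE`. -/
noncomputable def shiftedUnit {k E : Type*} [Field k] [Group E] {s : ℕ} (g : Fin s → E)
    (α : Fin s → k) : MonoidAlgebra k E :=
  1 + ∑ i, α i • (MonoidAlgebra.of k E (g i) - 1)

/-- The `kE`-module `M` has generic Jordan type `τ` with respect to the generators
`g_1, …, g_s` of `E`: for generic `α ∈ k^s`, that is, for all `α` in a nonempty (principal)
Zariski-open subset of `k^s`, the restriction of `M` to `⟨u_α⟩` has Jordan type `τ`,
i.e. `u_α - 1` acts on `M` as a nilpotent operator of Jordan type `τ`. -/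
def HasGenericJordanType {k E V : Type*} [Field k] [Group E] [AddCommGroup V] [Module k V]
    {s : ℕ} (g : Fin s → E) (ρ : Representation k E V) (τ : Multiset ℕ) : Prop :=
  ∃ f : MvPolynomial (Fin s) k, f ≠ 0 ∧
    ∀ α : Fin s → k, MvPolynomial.eval α f ≠ 0 →
      HasJordanType (ρ.asAlgebraHom (shiftedUnit g α - 1)) τ

/-- The stable generic Jordan type: the generic Jordan type with the projective summands, that is,
the blocks of size `p`, removed. -/
def HasStableGenericJordanType (p : ℕ) {k E V : Type*} [Field k] [Group E] [AddCommGroup V]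
    [Module k V] {s : ℕ} (g : Fin s → E) (ρ : Representation k E V) (σ : Multiset ℕ) : Prop :=
  ∃ τ : Multiset ℕ, HasGenericJordanType g ρ τ ∧ σ = τ.filter (· ≠ p)

/-! ### The multiplicity -/

/-- The set `Λ(u, v; s)` of pairs `(c₁, c₂)` of natural numbers with `c₁ ≤ u`, `c₂ ≤ v` and
`c₁ + c₂ = s`. -/
def lambdaPairs (u v s : ℕ) : Finset (ℕ × ℕ) :=
  (Finset.range (u + 1) ×ˢ Finset.range (v + 1)).filter fun c => c.1 + c.2 = s

/-! ### Tabloids are determined by their rows -/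

namespace YTableau

variable {μ : YoungDiagram} {n : ℕ}

/-! Since `r ≠ 0`, some letter `f` lies outside the first `s` blocks of `p` letters and so is fixed
by `E_s`. For a hook, a polytabloid whose tableau has `f` in the corner depends, up to sign, only on
its leg, a `b`-subset of the other letters. These polytabloids span by the Garnir relation
(`polytabloid_eq_sum_swap`) and are independent because each contains a tabloid that the others lack
(`coeff_polytabloid_mk`). They form a basis which the stabilizer of `f`, and hence `E_s`, permutes
up to sign (`exists_basis_spechtModule_hook`).

In such a signed permutation module, a basis vector sent to plus or minus itself by every generator
is fixed, as the generators have order `p` and `k` has characteristic `p`; it gives a block of size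
1. On the other basis vectors some `g_i` acts freely up to sign. When all `α_i ≠ 0`, that part
splits into blocks of size `p` under `u_α - 1` (`exists_hasJordanType_of_signed_permutation`).

A `b`-subset `A` is fixed by `g_i` exactly when it contains or misses the block of `g_i`, that is,
when the size of the intersection vanishes mod `p`. Otherwise `g_i` shifts the sum of the letters of
`A` in that block, mod `p`, by this nonzero size. Fixed subsets are counted by choosing `c` of the
`s` blocks and the remaining `b - cp` letters outside the blocks and different from `f`; this yields
`N(μ;s)`. -/

theorem ext_row_col (t : YTableau μ n) {m m' : Fin n} (hr : t.rowOf m = t.rowOf m')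
    (hc : t.colOf m = t.colOf m') : m = m' :=
  t.toEquiv.symm.injective (Subtype.ext (Prod.ext hr hc))

theorem exists_smul_eq (t t' : YTableau μ n) : ∃ τ : Equiv.Perm (Fin n), t' = τ • t := by
  refine ⟨t.toEquiv.symm.trans t'.toEquiv, ?_⟩
  change t' = ⟨t.toEquiv.trans (t.toEquiv.symm.trans t'.toEquiv)⟩
  cases t'
  congr 1
  ext x
  simp

theorem rowOf_smul_apply (σ : Equiv.Perm (Fin n)) (t : YTableau μ n) (m : Fin n) :
    (σ • t).rowOf (σ m) = t.rowOf m := by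
  simp [rowOf_smul]

theorem colOf_smul_apply (σ : Equiv.Perm (Fin n)) (t : YTableau μ n) (m : Fin n) :
    (σ • t).colOf (σ m) = t.colOf m := by
  simp [colOf_smul]

end YTableau

namespace YTabloid

variable {μ : YoungDiagram} {n : ℕ}

theorem mk_eq_mk_iff (t t' : YTableau μ n) : mk t = mk t' ↔ ∀ m, t.rowOf m = t'.rowOf m := by
  constructor
  · intro h
    obtain ⟨σ, hσ, rfl⟩ := Quotient.exact h
    intro m
    have := (inv_mem hσ : σ⁻¹ ∈ t.rowStabilizer) m
    rw [YTableau.rowOf_smul, this]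
  · intro h
    obtain ⟨σ, rfl⟩ := t.exists_smul_eq t'
    refine Quotient.sound ⟨σ, fun m => ?_, rfl⟩
    rw [h, YTableau.rowOf_smul_apply]

end YTabloid

/-! ### Polytabloids -/

section Polytabloid

variable {k : Type*} [Field k] {μ : YoungDiagram} {n : ℕ}

theorem polytabloid_smul_of_mem_colStabilizer {t : YTableau μ n} {τ : Equiv.Perm (Fin n)}
    (hτ : τ ∈ t.colStabilizer) :
    polytabloid k (τ • t) = ((Equiv.Perm.sign τ : ℤ) : k) • polytabloid k t := by
  classical
  unfold polytabloid
  rw [Finset.smul_sum]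
  refine Finset.sum_bij (fun σ _ => σ * τ) ?_ ?_ ?_ ?_
  · intro σ hσ
    simp only [Finset.mem_filter, Finset.mem_univ, true_and] at hσ ⊢
    have h := YTableau.conj_mem_colStabilizer hσ τ⁻¹
    rw [inv_smul_smul, inv_inv] at h
    simpa [mul_assoc] using mul_mem hτ h
  · intro σ _ σ' _ h
    simpa using h
  · intro σ hσ
    simp only [Finset.mem_filter, Finset.mem_univ, true_and] at hσ
    refine ⟨σ * τ⁻¹, ?_, by group⟩
    simp only [Finset.mem_filter, Finset.mem_univ, true_and]
    have h := YTableau.conj_mem_colStabilizer (mul_mem (inv_mem hτ) hσ) τ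
    simpa [mul_assoc] using h
  · intro σ _
    rw [mul_smul, MonoidAlgebra.smul_single, smul_eq_mul, map_mul, Units.val_mul, Int.cast_mul]
    congr 1
    rcases Int.units_eq_one_or (Equiv.Perm.sign τ) with h | h <;> simp [h]

theorem polytabloid_smul_eq_or_neg {t : YTableau μ n} {τ : Equiv.Perm (Fin n)}
    (hτ : τ ∈ t.colStabilizer) :
    polytabloid k (τ • t) = polytabloid k t ∨ polytabloid k (τ • t) = -polytabloid k t := by
  rw [polytabloid_smul_of_mem_colStabilizer hτ]
  rcases Int.units_eq_one_or (Equiv.Perm.sign τ) with h | h <;> simp [h]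

/-- Equality of the tableaux is not needed: a polytabloid sees only the tabloid and the column
stabilizer. -/
theorem polytabloid_congr {t t' : YTableau μ n} (hrow : ∀ m, t.rowOf m = t'.rowOf m)
    (hcol : ∀ σ, σ ∈ t.colStabilizer ↔ σ ∈ t'.colStabilizer) :
    polytabloid k t = polytabloid k t' := by
  classical
  unfold polytabloid
  have h : YTabloid.mk t = YTabloid.mk t' := (YTabloid.mk_eq_mk_iff _ _).2 hrow
  refine Finset.sum_congr (Finset.filter_congr fun σ _ => hcol σ) fun σ _ => ?_
  rw [← YTabloid.smul_mk, ← YTabloid.smul_mk, h]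

end Polytabloid

/-! ### Tableaux of hook shape -/

theorem mem_hookDiagram {a b : ℕ} {ha : 1 ≤ a} {c : ℕ × ℕ} :
    c ∈ hookDiagram a b ha ↔ (c.1 = 0 ∧ c.2 < a) ∨ (1 ≤ c.1 ∧ c.1 ≤ b ∧ c.2 = 0) := by
  unfold hookDiagram
  rw [YoungDiagram.mem_ofRowLens]
  obtain ⟨i, j⟩ := c
  rcases i with _ | i
  · simp
  · simp only [List.getElem_cons_succ, List.getElem_replicate, List.length_cons,
      List.length_replicate, exists_prop]
    omega

theorem card_cells_hookDiagram {a b : ℕ} (ha : 1 ≤ a) :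
    (hookDiagram a b ha).cells.card = a + b := by
  have h : (hookDiagram a b ha).cells =
      ((Finset.range a).image fun j => (0, j)) ∪ (Finset.range b).image fun i => (i + 1, 0) := by
    ext ⟨i, j⟩
    rw [YoungDiagram.mem_cells, mem_hookDiagram]
    simp only [Finset.mem_union, Finset.mem_image, Finset.mem_range, Prod.mk.injEq]
    constructor
    · rintro (⟨h1, h2⟩ | ⟨h1, h2, h3⟩)
      · exact Or.inl ⟨j, h2, h1.symm, rfl⟩
      · exact Or.inr ⟨i - 1, by omega, by omega, h3.symm⟩
    · rintro (⟨x, h1, h2, h3⟩ | ⟨x, h1, h2, h3⟩)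
      · left; constructor <;> omega
      · right; refine ⟨?_, ?_, ?_⟩ <;> omega
  rw [h, Finset.card_union_of_disjoint, Finset.card_image_of_injective,
    Finset.card_image_of_injective, Finset.card_range, Finset.card_range]
  · intro x y hxy; simpa using hxy
  · intro x y hxy; simpa using hxy
  · rw [Finset.disjoint_left]
    simp

namespace YTableau

section Hook

variable {a b : ℕ} {ha : 1 ≤ a} {n : ℕ}

theorem hook_row_eq_zero (t : YTableau (hookDiagram a b ha) n) {m : Fin n}
    (hm : t.colOf m ≠ 0) : t.rowOf m = 0 := by
  have h := (t.toEquiv.symm m).2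
  rw [YoungDiagram.mem_cells, mem_hookDiagram] at h
  rcases h with h | h
  · exact h.1
  · exact absurd h.2.2 hm

theorem hook_col_eq_zero (t : YTableau (hookDiagram a b ha) n) {m : Fin n}
    (hm : t.rowOf m ≠ 0) : t.colOf m = 0 := by
  by_contra h
  exact hm (t.hook_row_eq_zero h)

/-- Every column of a hook except the first is a single node. -/
theorem mem_colStabilizer_hook {t : YTableau (hookDiagram a b ha) n} {σ : Equiv.Perm (Fin n)} :
    σ ∈ t.colStabilizer ↔ ∀ m, t.colOf m ≠ 0 → σ m = m := by
  constructor
  · intro h m hm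
    refine t.ext_row_col ?_ (h m)
    rw [t.hook_row_eq_zero hm, t.hook_row_eq_zero (by rwa [h m])]
  · intro h m
    by_cases hm : t.colOf m = 0
    · rw [hm]
      by_contra h'
      have h2 := σ.injective (h _ h')
      rw [h2] at h'
      exact h' hm
    · rw [h m hm]

/-- The letter `f` lies in the corner node of `t`. -/
def HasCorner {μ : YoungDiagram} (t : YTableau μ n) (f : Fin n) : Prop :=
  t.rowOf f = 0 ∧ t.colOf f = 0

/-- The letters of `t` outside the first row. -/
def leg {μ : YoungDiagram} (t : YTableau μ n) : Finset (Fin n) :=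
  Finset.univ.filter fun m => t.rowOf m ≠ 0

theorem mem_leg {μ : YoungDiagram} {t : YTableau μ n} {m : Fin n} :
    m ∈ t.leg ↔ t.rowOf m ≠ 0 := by
  simp [leg]

theorem HasCorner.smul {μ : YoungDiagram} {t : YTableau μ n} {f : Fin n} (h : t.HasCorner f)
    (σ : Equiv.Perm (Fin n)) : (σ • t).HasCorner (σ f) :=
  ⟨(rowOf_smul_apply σ t f).trans h.1, (colOf_smul_apply σ t f).trans h.2⟩

theorem HasCorner.unique {μ : YoungDiagram} {t : YTableau μ n} {f f' : Fin n} (h : t.HasCorner f)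
    (h' : t.HasCorner f') : f = f' :=
  t.ext_row_col (h.1.trans h'.1.symm) (h.2.trans h'.2.symm)

theorem leg_smul {μ : YoungDiagram} (t : YTableau μ n) (σ : Equiv.Perm (Fin n)) :
    (σ • t).leg = t.leg.map σ.toEmbedding := by
  ext m
  rw [mem_leg, rowOf_smul, Finset.mem_map_equiv, mem_leg]
  rfl

theorem colOf_eq_zero_iff {t : YTableau (hookDiagram a b ha) n} {f : Fin n} (h : t.HasCorner f)
    {m : Fin n} : t.colOf m = 0 ↔ m = f ∨ m ∈ t.leg := by
  rw [mem_leg]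
  constructor
  · intro hm
    by_cases hr : t.rowOf m = 0
    · exact Or.inl (HasCorner.unique ⟨hr, hm⟩ h)
    · exact Or.inr hr
  · rintro (rfl | hm)
    · exact h.2
    · exact t.hook_col_eq_zero hm

theorem exists_hasCorner (t : YTableau (hookDiagram a b ha) n) : ∃ f, t.HasCorner f := by
  have h : ((0, 0) : ℕ × ℕ) ∈ (hookDiagram a b ha).cells := by
    rw [YoungDiagram.mem_cells, mem_hookDiagram]
    left
    exact ⟨rfl, ha⟩
  refine ⟨t.toEquiv ⟨(0, 0), h⟩, ?_, ?_⟩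
  · simp [rowOf]
  · simp [colOf]

theorem card_leg (t : YTableau (hookDiagram a b ha) n) : t.leg.card = b := by
  have h2 : t.leg = ((Finset.univ : Finset (hookDiagram a b ha).cells).filter
      fun c => c.1.1 ≠ 0).map t.toEquiv.toEmbedding := by
    ext m
    rw [mem_leg, Finset.mem_map_equiv]
    simp [rowOf]
  rw [h2, Finset.card_map]
  conv_rhs => rw [← Finset.card_range b]
  symm
  refine Finset.card_bij (fun i hi => ⟨(i + 1, 0), ?_⟩) ?_ ?_ ?_
  · rw [YoungDiagram.mem_cells, mem_hookDiagram]
    right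
    have := Finset.mem_range.1 hi
    refine ⟨?_, ?_, rfl⟩ <;> simp only <;> omega
  · intro i hi
    simp
  · intro i _ j _ h
    simpa using h
  · rintro ⟨⟨i, j⟩, hc⟩ h
    simp only [ne_eq, Finset.mem_filter, Finset.mem_univ, true_and] at h
    rw [YoungDiagram.mem_cells, mem_hookDiagram] at hc
    simp only at hc
    refine ⟨i - 1, ?_, ?_⟩
    · rw [Finset.mem_range]; omega
    · ext <;> simp only <;> omega

theorem exists_hasCorner_leg {A : Finset (Fin (a + b))} (hA : A.card = b) {f : Fin (a + b)}
    (hf : f ∉ A) : ∃ t : YTableau (hookDiagram a b ha) (a + b), t.HasCorner f ∧ t.leg = A := by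
  have e : (hookDiagram a b ha).cells ≃ Fin (a + b) :=
    Fintype.equivOfCardEq (by rw [Fintype.card_coe, card_cells_hookDiagram, Fintype.card_fin])
  set t : YTableau (hookDiagram a b ha) (a + b) := ⟨e⟩
  have hcard := t.card_leg
  let e' : {x // x ∈ t.leg} ≃ {x // x ∈ A} :=
    Fintype.equivOfCardEq (by rw [Fintype.card_coe, Fintype.card_coe, hcard, hA])
  have hmap : t.leg.map e'.extendSubtype.toEmbedding = A := by
    refine Finset.eq_of_subset_of_card_le ?_ (by rw [Finset.card_map, hcard, hA])
    intro x hx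
    obtain ⟨y, hy, rfl⟩ := Finset.mem_map.1 hx
    exact e'.extendSubtype_mem y hy
  obtain ⟨c, hc⟩ := t.exists_hasCorner
  have hcA : e'.extendSubtype c ∉ A :=
    e'.extendSubtype_not_mem c (by rw [mem_leg, hc.1]; simp)
  -- The first permutation moves the leg onto `A`; the swap then brings `f` into the corner and
  -- preserves `A`, which contains neither swapped letter.
  refine ⟨Equiv.swap (e'.extendSubtype c) f • e'.extendSubtype • t, ?_, ?_⟩
  · have := (hc.smul e'.extendSubtype).smul (Equiv.swap (e'.extendSubtype c) f)
    rwa [Equiv.swap_apply_left] at this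
  · rw [leg_smul, leg_smul, hmap]
    refine Finset.eq_of_subset_of_card_le ?_ (by rw [Finset.card_map])
    intro x hx
    obtain ⟨y, hy, rfl⟩ := Finset.mem_map.1 hx
    have h1 : y ≠ e'.extendSubtype c := fun h => hcA (h ▸ hy)
    have h2 : y ≠ f := fun h => hf (h ▸ hy)
    simpa [Equiv.swap_apply_of_ne_of_ne h1 h2] using hy

end Hook

end YTableau

/-! ### Polytabloids of hook shape: signs, the Garnir relation, independence -/

section HookPolytabloid

variable {k : Type*} [Field k] {a b : ℕ} {ha : 1 ≤ a} {n : ℕ}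

theorem polytabloid_eq_or_neg_of_leg_eq {t t' : YTableau (hookDiagram a b ha) n} {f : Fin n}
    (h : t.HasCorner f) (h' : t'.HasCorner f) (hl : t.leg = t'.leg) :
    polytabloid k t' = polytabloid k t ∨ polytabloid k t' = -polytabloid k t := by
  classical
  have hcol : ∀ m, t.colOf m = 0 ↔ t'.colOf m = 0 := fun m => by
    rw [YTableau.colOf_eq_zero_iff h, YTableau.colOf_eq_zero_iff h', hl]
  obtain ⟨τ, hτ⟩ := t.exists_smul_eq t'
  have hτp : ∀ m, t.colOf (τ m) = 0 ↔ t.colOf m = 0 := fun m => by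
    rw [hcol, hτ, YTableau.colOf_smul_apply]
  -- `σ` agrees with `τ` on the first column and is the identity elsewhere. Thus it is a column
  -- permutation, and `σ • t` differs from `t'` only in the order of the arm, which the polytabloid
  -- ignores.
  set σ : Equiv.Perm (Fin n) := Equiv.Perm.ofSubtype (τ.subtypePerm (p := fun m => t.colOf m = 0) hτp) with hσ
  have hσ1 : ∀ m, t.colOf m = 0 → σ m = τ m := fun m hm => by
    rw [hσ, Equiv.Perm.ofSubtype_apply_of_mem (p := fun m => t.colOf m = 0) _ hm]; rfl
  have hσ2 : ∀ m, t.colOf m ≠ 0 → σ m = m := fun m hm => by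
    rw [hσ, Equiv.Perm.ofSubtype_apply_of_not_mem (p := fun m => t.colOf m = 0) _ hm]
  have hσC : σ ∈ t.colStabilizer := YTableau.mem_colStabilizer_hook.2 hσ2
  have hσcol : ∀ m, (σ • t).colOf m = t.colOf m := fun m => by
    rw [YTableau.colOf_smul]
    exact (inv_mem hσC : σ⁻¹ ∈ t.colStabilizer) m
  have key : polytabloid k t' = polytabloid k (σ • t) := by
    refine polytabloid_congr (fun m => ?_) fun ρ => ?_
    · obtain ⟨m, rfl⟩ := σ.surjective m
      rw [YTableau.rowOf_smul_apply]
      by_cases hm : t.colOf m = 0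
      · rw [hσ1 m hm, hτ, YTableau.rowOf_smul_apply]
      · rw [hσ2 m hm, t.hook_row_eq_zero hm, t'.hook_row_eq_zero (by rwa [Ne, ← hcol])]
    · rw [YTableau.mem_colStabilizer_hook, YTableau.mem_colStabilizer_hook]
      refine forall_congr' fun m => ?_
      rw [hσcol, Ne, Ne, hcol]
  rw [key]
  exact polytabloid_smul_eq_or_neg hσC

/-- The Garnir relation for the first column of a hook and one further letter. -/
theorem polytabloid_eq_sum_swap (t : YTableau (hookDiagram a b ha) n) {f : Fin n}
    (hf : t.colOf f ≠ 0) :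
    polytabloid k t = ∑ y : Fin n with t.colOf y = 0, polytabloid k (Equiv.swap f y • t) := by
  classical
  obtain ⟨c, hc⟩ := t.exists_hasCorner
  have hcf : c ≠ f := by rintro rfl; exact hf hc.2
  set F : Equiv.Perm (Fin n) → MonoidAlgebra k (YTabloid (hookDiagram a b ha) n) := fun σ =>
    MonoidAlgebra.single (YTabloid.mk (σ • t)) ((Equiv.Perm.sign σ : ℤ) : k) with hF
  -- The symmetric group on the first column together with `f`.
  set S : Finset (Equiv.Perm (Fin n)) :=
    Finset.univ.filter fun σ => ∀ m, m ≠ f → t.colOf m ≠ 0 → σ m = m with hS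
  have hmemS : ∀ σ, σ ∈ S ↔ ∀ m, m ≠ f → t.colOf m ≠ 0 → σ m = m := fun σ => by simp [hS]
  -- The corner letter `c` and `f` share the first row of `t`, so right multiplication by their swap
  -- keeps the tabloid and reverses the sign.
  have hzero : ∑ σ ∈ S, F σ = 0 := by
    refine Finset.sum_involution (fun σ _ => σ * Equiv.swap c f) ?_ ?_ ?_ ?_
    · intro σ _
      have h1 : YTabloid.mk ((σ * Equiv.swap c f) • t) = YTabloid.mk (σ • t) := by
        rw [mul_smul, ← YTabloid.smul_mk, ← YTabloid.smul_mk σ t]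
        congr 1
        rw [YTabloid.mk_eq_mk_iff]
        intro m
        rw [YTableau.rowOf_smul, Equiv.swap_inv, Equiv.swap_apply_def]
        split_ifs with h1 h2
        · rw [h1, hc.1, t.hook_row_eq_zero hf]
        · rw [h2, hc.1, t.hook_row_eq_zero hf]
        · rfl
      simp only [hF, h1]
      rw [← MonoidAlgebra.single_add]
      simp [Equiv.Perm.sign_swap hcf]
    · intro σ _ _ h
      rw [mul_eq_left, Equiv.swap_eq_one_iff] at h
      exact hcf h
    · intro σ hσ
      rw [hmemS] at hσ ⊢
      intro m hm hm'
      rw [Equiv.Perm.mul_apply, Equiv.swap_apply_of_ne_of_ne (by rintro rfl; exact hm' hc.2) hm]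
      exact hσ m hm hm'
    · intro σ _
      simp [mul_assoc]
  -- Splitting by the image of `f` is the decomposition into cosets of `C_t`: the fibre over `f` is
  -- `C_t`, that over `y ≠ f` is the coset of the odd permutation `swap f y`.
  have hfib : ∀ y ∈ insert f (Finset.univ.filter fun y => t.colOf y = 0),
      ∑ σ ∈ S with σ f = y, F σ = if y = f then polytabloid k t else
        -polytabloid k (Equiv.swap f y • t) := by
    intro y hy
    have hy : y = f ∨ t.colOf y = 0 := by simpa using hy
    split_ifs with hyf
    · unfold polytabloid
      refine Finset.sum_congr ?_ fun _ _ => rfl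
      ext σ
      rw [Finset.mem_filter, hmemS, Finset.mem_filter, YTableau.mem_colStabilizer_hook, hyf]
      constructor
      · rintro ⟨h1, h2⟩
        refine ⟨Finset.mem_univ _, fun m hm => ?_⟩
        by_cases hmf : m = f
        · rw [hmf, h2]
        · exact h1 m hmf hm
      · rintro ⟨-, h⟩
        exact ⟨fun m _ hm => h m hm, h f hf⟩
    · have hy0 : t.colOf y = 0 := hy.resolve_left hyf
      rw [← ofMulAction_polytabloid]
      unfold polytabloid
      rw [map_sum, ← Finset.sum_neg_distrib]
      symm
      refine Finset.sum_bij (fun σ _ => Equiv.swap f y * σ) ?_ ?_ ?_ ?_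
      · intro σ hσ
        rw [Finset.mem_filter, YTableau.mem_colStabilizer_hook] at hσ
        rw [Finset.mem_filter, hmemS]
        refine ⟨fun m hm hm' => ?_, ?_⟩
        · rw [Equiv.Perm.mul_apply, hσ.2 m hm', Equiv.swap_apply_of_ne_of_ne hm]
          rintro rfl
          exact hm' hy0
        · rw [Equiv.Perm.mul_apply, hσ.2 f hf, Equiv.swap_apply_left]
      · intro σ _ σ' _ h
        simpa using h
      · intro σ hσ
        rw [Finset.mem_filter, hmemS] at hσ
        refine ⟨Equiv.swap f y * σ, ?_, by simp⟩
        rw [Finset.mem_filter, YTableau.mem_colStabilizer_hook]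
        refine ⟨Finset.mem_univ _, fun m hm => ?_⟩
        by_cases hmf : m = f
        · rw [hmf, Equiv.Perm.mul_apply, hσ.2, Equiv.swap_apply_right]
        · rw [Equiv.Perm.mul_apply, hσ.1 m hmf hm, Equiv.swap_apply_of_ne_of_ne hmf]
          rintro rfl
          exact hm hy0
      · intro σ _
        rw [Representation.ofMulAction_single, YTabloid.smul_mk, smul_smul, hF]
        simp only [map_mul, Equiv.Perm.sign_swap (Ne.symm hyf)]
        rw [← MonoidAlgebra.single_neg]
        simp
  rw [← Finset.sum_fiberwise_of_maps_to (g := fun σ => σ f)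
    (t := insert f (Finset.univ.filter fun y => t.colOf y = 0)), Finset.sum_congr rfl hfib,
    Finset.sum_insert (by simpa using hf), if_pos rfl, add_eq_zero_iff_eq_neg,
    ← Finset.sum_neg_distrib] at hzero
  · rw [hzero]
    refine Finset.sum_congr rfl fun y hy => ?_
    rw [if_neg, neg_neg]
    rintro rfl
    simp only [Finset.mem_filter] at hy
    exact hf hy.2
  · intro σ hσ
    rw [hmemS] at hσ
    simp only [Finset.mem_insert, Finset.mem_filter, Finset.mem_univ, true_and]
    by_contra! h
    have := σ.injective (hσ _ h.1 h.2)
    exact h.1 this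

theorem polytabloid_mem_span_hasCorner_of_colOf_eq_zero {t : YTableau (hookDiagram a b ha) n}
    {f : Fin n} (hf : t.colOf f = 0) :
    polytabloid k t ∈ Submodule.span k
      {v | ∃ t' : YTableau (hookDiagram a b ha) n, t'.HasCorner f ∧ v = polytabloid k t'} := by
  obtain ⟨c, hc⟩ := t.exists_hasCorner
  have hs : Equiv.swap c f ∈ t.colStabilizer := by
    rw [YTableau.mem_colStabilizer_hook]
    intro m hm
    refine Equiv.swap_apply_of_ne_of_ne ?_ ?_
    · rintro rfl; exact hm hc.2
    · rintro rfl; exact hm hf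
  have hmem : polytabloid k (Equiv.swap c f • t) ∈ Submodule.span k
      {v | ∃ t' : YTableau (hookDiagram a b ha) n, t'.HasCorner f ∧ v = polytabloid k t'} := by
    refine Submodule.subset_span ⟨_, ?_, rfl⟩
    have := hc.smul (Equiv.swap c f)
    rwa [Equiv.swap_apply_left] at this
  rcases polytabloid_smul_eq_or_neg (k := k) hs with h | h <;> rw [h] at hmem
  · exact hmem
  · simpa using hmem

theorem polytabloid_mem_span_hasCorner (t : YTableau (hookDiagram a b ha) n) (f : Fin n) :
    polytabloid k t ∈ Submodule.span k
      {v | ∃ t' : YTableau (hookDiagram a b ha) n, t'.HasCorner f ∧ v = polytabloid k t'} := by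
  by_cases hf : t.colOf f = 0
  · exact polytabloid_mem_span_hasCorner_of_colOf_eq_zero hf
  · rw [polytabloid_eq_sum_swap t hf]
    refine Submodule.sum_mem _ fun y hy => ?_
    refine polytabloid_mem_span_hasCorner_of_colOf_eq_zero ?_
    rw [YTableau.colOf_smul, Equiv.swap_inv, Equiv.swap_apply_left]
    simpa using hy

open scoped Classical in
-- A column permutation that keeps `f` in the first row must fix `f`, hence preserves the leg. So
-- `{t}` occurs in `e_{t'}` only if the legs agree, and in `e_t` only through the identity.
theorem coeff_polytabloid_mk {t t' : YTableau (hookDiagram a b ha) n} {f : Fin n}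
    (h : t.HasCorner f) (h' : t'.HasCorner f) (hl : t.leg = t'.leg → t = t') :
    (polytabloid k t').coeff (YTabloid.mk t) = if t = t' then 1 else 0 := by
  classical
  unfold polytabloid
  rw [MonoidAlgebra.coeff_sum, Finset.sum_apply']
  simp only [MonoidAlgebra.coeff_single, Finsupp.single_apply]
  have key : ∀ σ ∈ t'.colStabilizer, YTabloid.mk (σ • t') = YTabloid.mk t → t = t' := by
    intro σ hσ he
    rw [YTabloid.mk_eq_mk_iff] at he
    have hfix : σ⁻¹ f = f := by
      refine YTableau.HasCorner.unique ⟨?_, ?_⟩ h'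
      · rw [← YTableau.rowOf_smul, he, h.1]
      · rw [(inv_mem hσ : σ⁻¹ ∈ t'.colStabilizer) f, h'.2]
    refine hl ?_
    ext m
    rw [YTableau.mem_leg, ← he, YTableau.rowOf_smul, ← YTableau.mem_leg]
    have hcol : t'.colOf (σ⁻¹ m) = 0 ↔ t'.colOf m = 0 := by
      rw [(inv_mem hσ : σ⁻¹ ∈ t'.colStabilizer) m]
    rw [YTableau.colOf_eq_zero_iff h', YTableau.colOf_eq_zero_iff h'] at hcol
    have h1 : σ⁻¹ m = f ↔ m = f := by
      rw [← σ⁻¹.injective.eq_iff (a := m) (b := f), hfix]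
    have h2 : f ∉ t'.leg := by rw [YTableau.mem_leg, h'.1]; simp
    rw [h1] at hcol
    by_cases hm : m = f
    · rw [hm, hfix]
    · simpa [hm] using hcol
  split_ifs with htt
  · subst htt
    rw [Finset.sum_eq_single 1]
    · simp
    · intro σ hσ hσ1
      rw [if_neg]
      intro he
      rw [YTabloid.mk_eq_mk_iff] at he
      refine hσ1 (inv_eq_one.1 (Equiv.ext fun m => ?_))
      rw [Equiv.Perm.one_apply]
      refine t.ext_row_col ?_ ?_
      · rw [← YTableau.rowOf_smul, he]
      · exact (inv_mem (Finset.mem_filter.1 hσ).2 : σ⁻¹ ∈ t.colStabilizer) m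
    · intro h1
      exact absurd (Finset.mem_filter.2 ⟨Finset.mem_univ _, one_mem _⟩) h1
  · refine Finset.sum_eq_zero fun σ hσ => if_neg fun he => htt ?_
    exact key σ (Finset.mem_filter.1 hσ).2 he

end HookPolytabloid

/-! ### The standard basis of a hook Specht module at a chosen corner letter -/

/-- The Specht module of a hook has a basis indexed by the `b`-subsets of the letters other than
`f`, which the stabilizer of `f` permutes up to signs. -/
theorem exists_basis_spechtModule_hook (k : Type*) [Field k] {a b : ℕ} (ha : 1 ≤ a)
    (f : Fin (a + b)) :
    ∃ e : Module.Basis (Finset.powersetCard b (Finset.univ.erase f)) k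
        (SpechtModule k (hookDiagram a b ha) (a + b)),
      ∀ σ : Equiv.Perm (Fin (a + b)), σ f = f →
        ∀ A B : Finset.powersetCard b (Finset.univ.erase f), B.1 = A.1.map σ.toEmbedding →
          spechtRep k (hookDiagram a b ha) (a + b) σ (e A) = e B ∨
          spechtRep k (hookDiagram a b ha) (a + b) σ (e A) = -e B := by
  classical
  have hex : ∀ A : Finset.powersetCard b (Finset.univ.erase f),
      ∃ t : YTableau (hookDiagram a b ha) (a + b), t.HasCorner f ∧ t.leg = A.1 := by
    rintro ⟨A, hA⟩
    rw [Finset.mem_powersetCard] at hA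
    exact YTableau.exists_hasCorner_leg hA.2 fun h => (Finset.mem_erase.1 (hA.1 h)).1 rfl
  choose t ht htl using hex
  let v : Finset.powersetCard b (Finset.univ.erase f) →
      SpechtModule k (hookDiagram a b ha) (a + b) := fun A =>
    ⟨polytabloid k (t A), Submodule.subset_span ⟨t A, rfl⟩⟩
  have hv : LinearIndependent k v := by
    refine LinearIndependent.of_comp
      (spechtSubrep k (hookDiagram a b ha) (a + b)).toSubmodule.subtype ?_
    have hev : ∀ A B, (polytabloid k (t B)).coeff (YTabloid.mk (t A)) =
        if t A = t B then 1 else 0 := fun A B =>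
      coeff_polytabloid_mk (ht A) (ht B) fun h => by
        rw [htl, htl] at h
        rw [Subtype.ext h]
    -- The coefficients at the tabloids `{t A}` form a dual family.
    refine LinearIndependent.of_pairwise_dual_eq_zero_one _
      (fun A => (Finsupp.lapply (YTabloid.mk (t A))).comp
        (MonoidAlgebra.coeffLinearEquiv k).toLinearMap) ?_ ?_
    · intro A B hAB
      refine (hev A B).trans (if_neg fun h => hAB (Subtype.ext ?_))
      rw [← htl A, ← htl B, h]
    · intro A
      exact (hev A A).trans (if_pos rfl)
  have hcorner : ∀ t' : YTableau (hookDiagram a b ha) (a + b), t'.HasCorner f →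
      ∀ A : Finset.powersetCard b (Finset.univ.erase f), A.1 = t'.leg →
        polytabloid k t' = polytabloid k (t A) ∨ polytabloid k t' = -polytabloid k (t A) :=
    fun t' h' A hA => polytabloid_eq_or_neg_of_leg_eq (ht A) h' ((htl A).trans hA)
  have hspan : ⊤ ≤ Submodule.span k (Set.range v) := by
    rintro ⟨x, hx⟩ -
    have hle : (spechtSubrep k (hookDiagram a b ha) (a + b)).toSubmodule ≤
        (Submodule.span k (Set.range v)).map
          (spechtSubrep k (hookDiagram a b ha) (a + b)).toSubmodule.subtype := by
      refine Submodule.span_le.2 ?_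
      rintro _ ⟨t', rfl⟩
      refine Submodule.span_le.2 ?_ (polytabloid_mem_span_hasCorner t' f)
      rintro _ ⟨t', h', rfl⟩
      have hmem : t'.leg ∈ Finset.powersetCard b (Finset.univ.erase f) := by
        rw [Finset.mem_powersetCard, t'.card_leg]
        refine ⟨fun m hm => Finset.mem_erase.2 ⟨?_, Finset.mem_univ _⟩, rfl⟩
        rintro rfl
        exact YTableau.mem_leg.1 hm h'.1
      have hv' : polytabloid k (t ⟨_, hmem⟩) ∈ (Submodule.span k (Set.range v)).map
          (spechtSubrep k (hookDiagram a b ha) (a + b)).toSubmodule.subtype :=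
        ⟨v ⟨_, hmem⟩, Submodule.subset_span ⟨_, rfl⟩, rfl⟩
      rcases hcorner t' h' ⟨_, hmem⟩ rfl with h | h <;> rw [h]
      · exact hv'
      · exact neg_mem hv'
    obtain ⟨y, hy, rfl⟩ := hle hx
    exact hy
  refine ⟨Module.Basis.mk hv hspan, fun σ hσ A B hAB => ?_⟩
  rw [Module.Basis.mk_apply, Module.Basis.mk_apply]
  have h1 : (σ • t A).HasCorner f := by
    have := (ht A).smul σ
    rwa [hσ] at this
  have h2 : ((spechtRep k (hookDiagram a b ha) (a + b) σ (v A)) : MonoidAlgebra k _) =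
      polytabloid k (σ • t A) := ofMulAction_polytabloid k σ (t A)
  refine (hcorner _ h1 B ?_).imp (fun h => Subtype.ext (h2.trans h))
    fun h => Subtype.ext (h2.trans h)
  rw [hAB, YTableau.leg_smul, htl]

/-! ### Recognizing Jordan types -/

section Jordan

variable {k V : Type*} [Field k] [AddCommGroup V] [Module k V]

/-- Spanning strings with as many vectors in total as the dimension form a basis, so independence
need not be checked. -/
theorem hasJordanType_of_span {κ : Type*} [Fintype κ] (T : Module.End k V) (ℓ : κ → ℕ)
    (hℓ : ∀ j, 1 ≤ ℓ j) (w : κ → V) (hT : ∀ j, (T ^ ℓ j) (w j) = 0)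
    (hspan : ∀ U : Submodule k V, (∀ j, ∀ i < ℓ j, (T ^ i) (w j) ∈ U) → U = ⊤)
    (hcard : Module.finrank k V = ∑ j, ℓ j) :
    HasJordanType T (Finset.univ.val.map ℓ) := by
  let ε := Fintype.equivFin κ
  let v : (Σ j : Fin (Fintype.card κ), Fin (ℓ (ε.symm j))) → V := fun x =>
    (T ^ x.2.val) (w (ε.symm x.1))
  have hv : ⊤ ≤ Submodule.span k (Set.range v) := by
    refine (hspan _ fun j i hi => Submodule.subset_span ?_).ge
    obtain ⟨j, rfl⟩ := ε.symm.surjective j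
    exact ⟨⟨j, ⟨i, hi⟩⟩, rfl⟩
  have hc : Fintype.card (Σ j : Fin (Fintype.card κ), Fin (ℓ (ε.symm j))) =
      Module.finrank k V := by
    rw [Fintype.card_sigma, hcard]
    simp only [Fintype.card_fin]
    exact ε.symm.sum_comp ℓ
  refine ⟨Fintype.card κ, fun j => ℓ (ε.symm j), basisOfTopLeSpanOfCardEqFinrank v hv hc,
    fun j => hℓ _, ?_, fun j i => ?_⟩
  · have h : (Finset.univ : Finset κ).val = Finset.univ.val.map ε.symm := by
      rw [← Finset.map_univ_equiv ε.symm]; rfl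
    rw [h, Multiset.map_map]
    rfl
  · rw [coe_basisOfTopLeSpanOfCardEqFinrank]
    have h1 : T (v ⟨j, i⟩) = (T ^ (i.val + 1)) (w (ε.symm j)) := by
      rw [pow_succ', Module.End.mul_apply]
    rw [h1]
    split_ifs with h
    · rfl
    · have : i.val + 1 = ℓ (ε.symm j) := le_antisymm i.2 (not_lt.1 h)
      rw [this, hT]

end Jordan

/-! ### Counting by a shifted coordinate mod `p` -/

section FreeShift

variable {p : ℕ} [Fact p.Prime]

theorem zmod_apply_pow_perm {N : Type*} (f : Equiv.Perm N) (φ : N → ZMod p)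
    (h : ∀ x, φ (f x) = φ x + 1) (m : ℕ) (x : N) : φ ((f ^ m) x) = φ x + m := by
  induction m with
  | zero => simp
  | succ m ih => rw [pow_succ', Equiv.Perm.mul_apply, h, ih]; push_cast; ring

/-- Moving `x` back by `φ x` steps lands in the zero fibre, which identifies `N` with `ZMod p` times
that fibre. -/
theorem card_eq_mul_card_fiber_of_shift {N : Type*} [Fintype N] (f : Equiv.Perm N)
    (φ : N → ZMod p) (h : ∀ x, φ (f x) = φ x + 1) :
    Fintype.card N = p * Fintype.card {x // φ x = 0} := by
  have hinv : ∀ (m : ℕ) x, φ ((f ^ m)⁻¹ x) = φ x - m := fun m x => by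
    have := zmod_apply_pow_perm f φ h m ((f ^ m)⁻¹ x)
    rw [show (f ^ m) ((f ^ m)⁻¹ x) = x from Equiv.apply_symm_apply _ _] at this
    rw [this]; ring
  have e : N ≃ ZMod p × {x // φ x = 0} :=
    { toFun := fun x => (φ x, ⟨(f ^ (φ x).val)⁻¹ x, by rw [hinv]; simp⟩)
      invFun := fun y => (f ^ y.1.val) y.2.1
      left_inv := fun x => by simp
      right_inv := by
        rintro ⟨c, x, hx⟩
        have h2 : φ ((f ^ c.val) x) = c := by
          rw [zmod_apply_pow_perm f φ h, hx]; simp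
        refine Prod.ext h2 (Subtype.ext ?_)
        simp only [h2]
        exact Equiv.symm_apply_apply _ _ }
  rw [Fintype.card_congr e, Fintype.card_prod, ZMod.card]

end FreeShift

/-! ### Signed permutation modules of elementary abelian groups -/

section SignedPermutation

variable {k V : Type*} [Field k] [AddCommGroup V] [Module k V] (p : ℕ) [CharP k p]

theorem natCast_prime_end_eq_zero : ((p : ℕ) : Module.End k V) = 0 := by
  ext v
  rw [Module.End.natCast_apply, ← Nat.cast_smul_eq_nsmul k]
  simp

variable [Fact p.Prime]

theorem add_pow_prime_end {x y : Module.End k V} (h : Commute x y) :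
    (x + y) ^ p = x ^ p + y ^ p := by
  obtain ⟨r, hr⟩ := h.exists_add_pow_prime_eq (Fact.out : p.Prime)
  rw [hr, natCast_prime_end_eq_zero p]
  simp

theorem sub_one_pow_prime_end {x : Module.End k V} (h : x ^ p = 1) : (x - 1) ^ p = 0 := by
  have := add_pow_prime_end p (Commute.one_right (x - 1))
  rw [sub_add_cancel, h, one_pow] at this
  simpa using this

/-- Raising to the power `p` is additive on commuting operators, and `(G i - 1) ^ p = G i ^ p - 1 =
0`. -/
theorem sum_smul_sub_one_pow_prime {s : ℕ} {G : Fin s → Module.End k V}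
    (hcomm : ∀ i j, Commute (G i) (G j)) (hp : ∀ i, G i ^ p = 1) (α : Fin s → k) :
    (∑ i, α i • (G i - 1)) ^ p = 0 := by
  classical
  have hc : ∀ i j, Commute (α i • (G i - 1)) (α j • (G j - 1)) := fun i j =>
    ((((hcomm i j).sub_left (Commute.one_left _)).sub_right
      (Commute.one_right _)).smul_left _).smul_right _
  induction (Finset.univ : Finset (Fin s)) using Finset.induction_on with
  | empty => simp [(Fact.out : p.Prime).ne_zero]
  | insert i S hi ih =>
    rw [Finset.sum_insert hi, add_pow_prime_end p (Commute.sum_right _ _ _ fun j _ => hc i j), ih,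
      smul_pow, sub_one_pow_prime_end p (hp i)]
    simp

/-- If `G v = -v`, then `v = G ^ p v = (-1) ^ p v = -v`, including when `p = 2`. -/
theorem apply_eq_self_of_eq_or_neg {G : Module.End k V} (hp : G ^ p = 1) {v : V}
    (h : G v = v ∨ G v = -v) : G v = v := by
  rcases h with h | h
  · exact h
  · have h2 : ∀ m : ℕ, (G ^ m) v = (-1 : k) ^ m • v := by
      intro m
      induction m with
      | zero => simp
      | succ m ih => rw [pow_succ', Module.End.mul_apply, ih, map_smul, h, pow_succ]; simp
    have h3 := h2 p
    rw [hp, neg_one_pow_char k p] at h3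
    rw [h]
    simpa using h3.symm

/-- A module with a basis that is permuted up to signs by commuting operators `G i` of order `p`.
Every operator `G i` moves freely the basis elements with `size x i ≠ 0` and fixes the others, the
coordinate `pos x i` measuring the position in the orbit. Then `∑ α i • (G i - 1)` has, for nonzero
`α i`, one Jordan block of size `1` for every common fixed basis element, and all its other Jordan
blocks have size `p`. -/
theorem exists_hasJordanType_of_signed_permutation {ι : Type*} [Fintype ι] {s : ℕ} (hs : 1 ≤ s)
    (e : Module.Basis ι k V) (G : Fin s → Module.End k V)
    (hcomm : ∀ i j, Commute (G i) (G j)) (hp : ∀ i, G i ^ p = 1) (act : Fin s → Equiv.Perm ι)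
    (hG : ∀ i x, G i (e x) = e (act i x) ∨ G i (e x) = -e (act i x))
    (size pos : ι → Fin s → ZMod p) (hsize : ∀ i x, size (act i x) = size x)
    (hpos : ∀ i x, pos (act i x) i = pos x i + size x i)
    (hpos' : ∀ i j x, j ≠ i → pos (act i x) j = pos x j)
    (hfix : ∀ i x, size x i = 0 → act i x = x) :
    ∃ M : ℕ, ∀ α : Fin s → k, (∀ i, α i ≠ 0) →
      HasJordanType (∑ i, α i • (G i - 1))
        (Multiset.replicate (Nat.card {x // size x = 0}) 1 + Multiset.replicate M p) := by
  classical
  -- A freely moving generator is chosen from the size vector alone. That vector is invariant under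
  -- every `act i`, so the choice is constant on orbits. For the zero vector the value is a dummy,
  -- available because `s ≥ 1`.
  have hi0 : ∀ c : Fin s → ZMod p, ∃ i, c ≠ 0 → c i ≠ 0 := by
    intro c
    by_cases h : c = 0
    · exact ⟨⟨0, hs⟩, fun h' => absurd h h'⟩
    · obtain ⟨i, hi⟩ := Function.ne_iff.1 h
      exact ⟨i, fun _ => hi⟩
  choose i0 hi0 using hi0
  -- the free part and its rotation
  let N := {x // size x ≠ 0}
  let φ : N → ZMod p := fun x => pos x.1 (i0 (size x.1)) / size x.1 (i0 (size x.1))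
  let rot : N → N := fun x => ⟨act (i0 (size x.1)) x.1, by rw [hsize]; exact x.2⟩
  have hrot : Function.Injective rot := by
    rintro ⟨x, hx⟩ ⟨y, hy⟩ h
    have h1 : act (i0 (size x)) x = act (i0 (size y)) y := congrArg Subtype.val h
    have h2 : size x = size y := by rw [← hsize (i0 (size x)) x, h1, hsize]
    rw [h2] at h1
    exact Subtype.ext ((act _).injective h1)
  let f : Equiv.Perm N := Equiv.ofBijective rot (Finite.injective_iff_bijective.1 hrot)
  have hφ : ∀ x, φ (f x) = φ x + 1 := by
    rintro ⟨x, hx⟩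
    change pos (act _ x) (i0 (size (act _ x))) / size (act _ x) (i0 (size (act _ x))) = _
    rw [hsize, hpos, add_div, div_self (hi0 _ hx)]
  have hNcard := card_eq_mul_card_fiber_of_shift f φ hφ
  let Q := {x : N // φ x = 0}
  have hQ : ∀ x (hx : size x ≠ 0), φ ⟨x, hx⟩ = 0 ↔ pos x (i0 (size x)) = 0 := fun x hx => by
    change pos x _ / size x _ = 0 ↔ _
    rw [div_eq_zero_iff, or_iff_left (hi0 _ hx)]
  refine ⟨Fintype.card Q, fun α hα => ?_⟩
  set T := ∑ i, α i • (G i - 1) with hTdef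
  have hTp : T ^ p = 0 := sum_smul_sub_one_pow_prime p hcomm hp α
  have hTG : ∀ i, Commute (G i) T := fun i =>
    Commute.sum_right _ _ _ fun j _ => ((hcomm i j).sub_right (Commute.one_right _)).smul_right _
  have hcard1 : Nat.card {x // size x = 0} = Fintype.card {x // size x = 0} :=
    Nat.card_eq_fintype_card
  let ℓ : {x // size x = 0} ⊕ Q → ℕ := Sum.elim (fun _ => 1) fun _ => p
  have hτ : Multiset.replicate (Nat.card {x // size x = 0}) 1 +
      Multiset.replicate (Fintype.card Q) p = Finset.univ.val.map ℓ := by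
    rw [hcard1]
    change _ = Multiset.map ℓ (Multiset.disjSum _ _)
    rw [Multiset.disjSum, Multiset.map_add, Multiset.map_map, Multiset.map_map]
    congr 1
    · symm
      refine Multiset.eq_replicate.2 ⟨by rw [Multiset.card_map]; rfl, fun b hb => ?_⟩
      obtain ⟨_, _, rfl⟩ := Multiset.mem_map.1 hb
      rfl
    · symm
      refine Multiset.eq_replicate.2 ⟨by rw [Multiset.card_map]; rfl, fun b hb => ?_⟩
      obtain ⟨_, _, rfl⟩ := Multiset.mem_map.1 hb
      rfl
  rw [hτ]
  refine hasJordanType_of_span T ℓ ?_ (Sum.elim (fun x => e x.1) fun x => e x.1.1) ?_ ?_ ?_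
  · rintro (x | x)
    · exact le_rfl
    · exact (Fact.out : p.Prime).one_lt.le
  · rintro (⟨x, hx⟩ | x)
    · change (T ^ 1) (e x) = 0
      rw [pow_one, hTdef, LinearMap.sum_apply]
      refine Finset.sum_eq_zero fun i _ => ?_
      have h1 : act i x = x := hfix i x (by rw [hx]; rfl)
      have h2 := hG i x
      rw [h1] at h2
      simp [apply_eq_self_of_eq_or_neg p (hp i) h2]
    · change (T ^ p) (e x.1.1) = 0
      rw [hTp]; rfl
  · intro U hU
    rw [eq_top_iff, ← e.span_eq, Submodule.span_le]
    rintro _ ⟨x, rfl⟩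
    by_cases hx : size x = 0
    · exact hU (Sum.inl ⟨x, hx⟩) 0 (by simp [ℓ])
    · set i := i0 (size x) with hi
      -- The strings starting at position 0 for the fixed generator `i`. Their span will be shown
      -- stable under `T`, then under `G j` for `j ≠ i`, and finally under `G i`.
      let S : Set V := {v | ∃ (y : ι) (j : ℕ), size y ≠ 0 ∧ i0 (size y) = i ∧ pos y i = 0 ∧
        v = (T ^ j) (e y)}
      have hSU : Submodule.span k S ≤ U := by
        rw [Submodule.span_le]
        rintro _ ⟨y, j, hy, hyi, hy0, rfl⟩
        by_cases hj : j < p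
        · exact hU (Sum.inr ⟨⟨y, hy⟩, (hQ y hy).2 (by rw [hyi, hy0])⟩) j hj
        · rw [pow_eq_zero_of_le (not_lt.1 hj) hTp]
          exact U.zero_mem
      have hTS : ∀ v ∈ Submodule.span k S, T v ∈ Submodule.span k S := by
        intro v hv
        induction hv using Submodule.span_induction with
        | mem v hv =>
          obtain ⟨y, j, hy, hyi, hy0, rfl⟩ := hv
          refine Submodule.subset_span ⟨y, j + 1, hy, hyi, hy0, ?_⟩
          rw [pow_succ', Module.End.mul_apply]
        | zero => rw [map_zero]; exact zero_mem _
        | add v w _ _ h1 h2 => rw [map_add]; exact add_mem h1 h2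
        | smul c v _ h => rw [map_smul]; exact Submodule.smul_mem _ c h
      have hGS' : ∀ j, j ≠ i → ∀ v ∈ Submodule.span k S, G j v ∈ Submodule.span k S := by
        intro j hj v hv
        induction hv using Submodule.span_induction with
        | mem v hv =>
          obtain ⟨y, m, hy, hyi, hy0, rfl⟩ := hv
          have h1 : G j ((T ^ m) (e y)) = (T ^ m) (G j (e y)) := by
            rw [← Module.End.mul_apply, ((hTG j).pow_right m).eq, Module.End.mul_apply]
          have h2 : (T ^ m) (e (act j y)) ∈ Submodule.span k S :=
            Submodule.subset_span ⟨act j y, m, by rwa [hsize], by rwa [hsize],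
              by rwa [hpos' _ _ _ hj.symm], rfl⟩
          rw [h1]
          rcases hG j y with h | h <;> rw [h]
          · exact h2
          · rw [map_neg]; exact neg_mem h2
        | zero => rw [map_zero]; exact zero_mem _
        | add v w _ _ h1 h2 => rw [map_add]; exact add_mem h1 h2
        | smul c v _ h => rw [map_smul]; exact Submodule.smul_mem _ c h
      have hGS : ∀ v ∈ Submodule.span k S, G i v ∈ Submodule.span k S := by
        intro v hv
        -- Since `α i ≠ 0`, the action of `G i` can be solved for from those of `T` and the other `G
        -- j`.
        have h1 : T v = α i • (G i v - v) + ∑ j ∈ Finset.univ.erase i, α j • (G j v - v) := by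
          rw [Finset.add_sum_erase _ (fun j => α j • (G j v - v)) (Finset.mem_univ i), hTdef,
            LinearMap.sum_apply]
          rfl
        have h2 : ∑ j ∈ Finset.univ.erase i, α j • (G j v - v) ∈ Submodule.span k S :=
          Submodule.sum_mem _ fun j hj => Submodule.smul_mem _ _
            (sub_mem (hGS' j (Finset.ne_of_mem_erase hj) v hv) hv)
        have h3 : α i • (G i v - v) ∈ Submodule.span k S := by
          rw [← sub_eq_iff_eq_add] at h1
          rw [← h1]
          exact sub_mem (hTS v hv) h2
        rw [Submodule.smul_mem_iff _ (hα i)] at h3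
        simpa using add_mem h3 hv
      have hGpow : ∀ (m : ℕ), ∀ v ∈ Submodule.span k S, (G i ^ m) v ∈ Submodule.span k S := by
        intro m v hv
        induction m with
        | zero => simpa using hv
        | succ m ih => rw [pow_succ', Module.End.mul_apply]; exact hGS _ ih
      have hGe : ∀ m : ℕ, size ((act i ^ m) x) = size x ∧
          pos ((act i ^ m) x) i = pos x i + m * size x i ∧
          ((G i ^ m) (e x) = e ((act i ^ m) x) ∨ (G i ^ m) (e x) = -e ((act i ^ m) x)) := by
        intro m
        induction m with
        | zero => simp
        | succ m ih =>
          obtain ⟨h1, h2, h3⟩ := ih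
          rw [pow_succ', Equiv.Perm.mul_apply, pow_succ', Module.End.mul_apply]
          refine ⟨by rw [hsize, h1], ?_, ?_⟩
          · rw [hpos, h2, h1]; push_cast; ring
          · rcases h3 with h3 | h3 <;> rcases hG i ((act i ^ m) x) with h4 | h4 <;>
              simp [h3, h4]
      apply hSU
      -- `m` solves `pos x i + m * size x i = 0`, so `m` steps of `act i` bring `x` to position 0.
      set m := (-(pos x i) / size x i : ZMod p).val with hm
      obtain ⟨h1, h2, h3⟩ := hGe m
      have h4 : pos ((act i ^ m) x) i = 0 := by
        rw [h2, hm, ZMod.natCast_val, ZMod.cast_id, div_mul_cancel₀ _ (hi0 _ hx), add_neg_cancel]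
      have h5 : e ((act i ^ m) x) ∈ Submodule.span k S :=
        Submodule.subset_span ⟨_, 0, by rwa [h1], by rw [h1], h4, rfl⟩
      have h6 : (G i ^ m) (e x) ∈ Submodule.span k S := by
        rcases h3 with h | h <;> rw [h]
        · exact h5
        · exact neg_mem h5
      -- As `G i ^ p = 1`, the power `(p - 1) * m` undoes the `m` steps and returns to `e x`.
      have h7 := hGpow ((p - 1) * m) _ h6
      rw [← Module.End.mul_apply, ← pow_add] at h7
      have h8 : (p - 1) * m + m = p * m := by
        have := (Fact.out : p.Prime).one_lt
        obtain ⟨q, rfl⟩ : ∃ q, p = q + 1 := ⟨p - 1, by omega⟩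
        simp; ring
      rw [h8, pow_mul, hp, one_pow] at h7
      exact h7
  · have h1 : Fintype.card ι = Fintype.card {x // size x = 0} + Fintype.card N := by
      rw [← Fintype.card_sum]
      exact Fintype.card_congr (Equiv.sumCompl fun x => size x = 0).symm
    rw [Module.finrank_eq_card_basis e, h1, hNcard, Fintype.sum_sum_type]
    simp [ℓ, Q, mul_comm]

end SignedPermutation

/-! ### The generating cycles -/

section BlockCycle

variable {p n : ℕ}

/-- The letters moved by the cycle `blockCycle p n i`. -/
def letterBlock (p n i : ℕ) : Finset (Fin n) :=
  Finset.univ.filter fun m => i * p ≤ m.val ∧ m.val < (i + 1) * p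

theorem mem_letterBlock {i : ℕ} {m : Fin n} :
    m ∈ letterBlock p n i ↔ i * p ≤ m.val ∧ m.val < (i + 1) * p := by
  simp [letterBlock]

theorem eq_of_mem_letterBlock {i j : ℕ} {m : Fin n} (hi : m ∈ letterBlock p n i)
    (hj : m ∈ letterBlock p n j) : i = j := by
  rw [mem_letterBlock] at hi hj
  have h1 : i < j + 1 := lt_of_mul_lt_mul_right (hi.1.trans_lt hj.2) p.zero_le
  have h2 : j < i + 1 := lt_of_mul_lt_mul_right (hj.1.trans_lt hi.2) p.zero_le
  omega

/-- The `j`-th letter of a block. -/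
def blockLetter {i : ℕ} (hi : (i + 1) * p ≤ n) (j : Fin p) : Fin n :=
  ⟨i * p + j.val, by have := j.2; rw [add_mul] at hi; omega⟩

theorem blockLetter_injective {i : ℕ} (hi : (i + 1) * p ≤ n) :
    Function.Injective (blockLetter hi) := by
  intro j j' h
  have := congrArg Fin.val h
  simp only [blockLetter] at this
  exact Fin.ext (by omega)

theorem mem_letterBlock_iff_exists {i : ℕ} (hi : (i + 1) * p ≤ n) {m : Fin n} :
    m ∈ letterBlock p n i ↔ ∃ j, blockLetter hi j = m := by
  rw [mem_letterBlock]
  constructor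
  · intro h
    have h2 := h.2
    rw [add_mul] at h2
    exact ⟨⟨m.val - i * p, by omega⟩, Fin.ext (by simp only [blockLetter]; omega)⟩
  · rintro ⟨j, rfl⟩
    have := j.2
    simp only [blockLetter, add_mul]
    omega

theorem card_letterBlock {i : ℕ} (hi : (i + 1) * p ≤ n) : (letterBlock p n i).card = p := by
  have h : letterBlock p n i = Finset.univ.image (blockLetter hi) := by
    ext m
    simp [mem_letterBlock_iff_exists hi]
  rw [h, Finset.card_image_of_injective _ (blockLetter_injective hi), Finset.card_univ,
    Fintype.card_fin]

theorem filter_finRange_eq_map_blockLetter {i : ℕ} (hi : (i + 1) * p ≤ n) :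
    ((List.finRange n).filter fun m => i * p ≤ m.val ∧ m.val < (i + 1) * p) =
      (List.finRange p).map (blockLetter hi) := by
  -- Two strictly increasing lists with the same entries coincide.
  refine List.Perm.eq_of_pairwise (le := (· < ·)) (fun x y _ _ h1 h2 => absurd h1 h2.asymm)
    ((List.pairwise_lt_finRange n).filter _) ?_ ?_
  · rw [List.pairwise_map]
    refine (List.pairwise_lt_finRange p).imp fun {j j'} h => ?_
    simp only [blockLetter, Fin.mk_lt_mk]
    have : j.val < j'.val := h
    omega
  · rw [List.perm_ext_iff_of_nodup ((List.nodup_finRange n).filter _)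
      ((List.nodup_finRange p).map (blockLetter_injective hi))]
    intro m
    simpa [mem_letterBlock] using mem_letterBlock_iff_exists (p := p) hi (m := m)

theorem blockCycle_eq_formPerm {i : ℕ} (hi : (i + 1) * p ≤ n) :
    blockCycle p n i = ((List.finRange p).map (blockLetter hi)).formPerm := by
  rw [blockCycle, filter_finRange_eq_map_blockLetter hi]

theorem blockCycle_apply_of_notMem {i : ℕ} {m : Fin n} (hm : m ∉ letterBlock p n i) :
    blockCycle p n i m = m := by
  refine List.formPerm_apply_of_notMem fun h => hm ?_
  rw [mem_letterBlock]
  simpa using h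

theorem blockCycle_apply_blockLetter {i : ℕ} (hi : (i + 1) * p ≤ n) (j : Fin p) :
    blockCycle p n i (blockLetter hi j) =
      blockLetter hi ⟨(j.val + 1) % p, Nat.mod_lt _ (Nat.zero_lt_of_lt j.2)⟩ := by
  have h := List.formPerm_apply_getElem ((List.finRange p).map (blockLetter hi))
    ((List.nodup_finRange p).map (blockLetter_injective hi)) j.val (by simp)
  rw [blockCycle_eq_formPerm hi]
  simpa using h

theorem blockCycle_mem_letterBlock_iff {i j : ℕ} (hi : (i + 1) * p ≤ n) {m : Fin n} :
    blockCycle p n i m ∈ letterBlock p n j ↔ m ∈ letterBlock p n j := by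
  by_cases hm : m ∈ letterBlock p n i
  · have h2 : blockCycle p n i m ∈ letterBlock p n i := by
      obtain ⟨l, rfl⟩ := (mem_letterBlock_iff_exists hi).1 hm
      rw [blockCycle_apply_blockLetter, mem_letterBlock_iff_exists hi]
      exact ⟨_, rfl⟩
    constructor
    · intro h; rwa [← eq_of_mem_letterBlock h2 h]
    · intro h; rwa [← eq_of_mem_letterBlock hm h]
  · rw [blockCycle_apply_of_notMem hm]

/-- The wrap-around at the end of a block is invisible mod `p`. -/
theorem cast_blockCycle {i : ℕ} (hi : (i + 1) * p ≤ n) {m : Fin n} (hm : m ∈ letterBlock p n i) :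
    ((blockCycle p n i m).val : ZMod p) = (m.val : ZMod p) + 1 := by
  obtain ⟨l, rfl⟩ := (mem_letterBlock_iff_exists hi).1 hm
  rw [blockCycle_apply_blockLetter]
  simp only [blockLetter]
  push_cast
  rw [ZMod.natCast_mod]
  push_cast
  ring

theorem blockCycle_pow {i : ℕ} (hi : (i + 1) * p ≤ n) : blockCycle p n i ^ p = 1 := by
  have h := List.formPerm_pow_length_eq_one_of_nodup ((List.finRange p).map (blockLetter hi))
    ((List.nodup_finRange p).map (blockLetter_injective hi))
  rwa [← blockCycle_eq_formPerm hi, List.length_map, List.length_finRange] at h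

theorem commute_blockCycle (i j : ℕ) : Commute (blockCycle p n i) (blockCycle p n j) := by
  by_cases hij : i = j
  · rw [hij]
  · refine Equiv.Perm.Disjoint.commute fun m => ?_
    by_cases hm : m ∈ letterBlock p n i
    · exact Or.inr (blockCycle_apply_of_notMem fun h => hij (eq_of_mem_letterBlock hm h))
    · exact Or.inl (blockCycle_apply_of_notMem hm)

theorem sum_filter_map_blockCycle {M : Type*} [AddCommMonoid M] {i j : ℕ} (hi : (i + 1) * p ≤ n)
    (A : Finset (Fin n)) (F : Fin n → M) :
    ∑ m ∈ A.map (blockCycle p n i).toEmbedding with m ∈ letterBlock p n j, F m =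
      ∑ m ∈ A with m ∈ letterBlock p n j, F (blockCycle p n i m) := by
  rw [Finset.sum_filter, Finset.sum_map, Finset.sum_filter]
  refine Finset.sum_congr rfl fun m _ => ?_
  simp only [Equiv.toEmbedding_apply, blockCycle_mem_letterBlock_iff hi]

/-- The intersection has between `0` and `p` elements, so its size vanishes mod `p` only at the two
extremes. -/
theorem filter_letterBlock_eq_empty_or_subset [Fact p.Prime] {i : ℕ} (hi : (i + 1) * p ≤ n)
    {A : Finset (Fin n)} :
    ((A.filter (· ∈ letterBlock p n i)).card : ZMod p) = 0 ↔
      A.filter (· ∈ letterBlock p n i) = ∅ ∨ letterBlock p n i ⊆ A := by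
  have hsub : A.filter (· ∈ letterBlock p n i) ⊆ letterBlock p n i := fun m hm =>
    (Finset.mem_filter.1 hm).2
  constructor
  · intro h
    rw [ZMod.natCast_eq_zero_iff] at h
    have hle := Finset.card_le_card hsub
    rw [card_letterBlock hi] at hle
    rcases Nat.eq_zero_or_pos (A.filter (· ∈ letterBlock p n i)).card with h0 | h0
    · exact Or.inl (Finset.card_eq_zero.1 h0)
    · right
      have h1 := Nat.le_of_dvd h0 h
      rw [← Finset.eq_of_subset_of_card_le hsub (by rwa [card_letterBlock hi])]
      exact Finset.filter_subset _ _
  · rintro (h | h)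
    · simp [h]
    · rw [Finset.filter_mem_eq_inter, Finset.inter_eq_right.2 h, card_letterBlock hi]
      simp

theorem map_blockCycle_eq_self [Fact p.Prime] {i : ℕ} (hi : (i + 1) * p ≤ n) {A : Finset (Fin n)}
    (hA : ((A.filter (· ∈ letterBlock p n i)).card : ZMod p) = 0) :
    A.map (blockCycle p n i).toEmbedding = A := by
  refine Finset.eq_of_subset_of_card_le ?_ (by rw [Finset.card_map])
  intro x hx
  obtain ⟨y, hy, rfl⟩ := Finset.mem_map.1 hx
  rw [Equiv.toEmbedding_apply]
  by_cases hyi : y ∈ letterBlock p n i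
  · rcases (filter_letterBlock_eq_empty_or_subset hi).1 hA with h | h
    · exact absurd (Finset.mem_filter.2 ⟨hy, hyi⟩) (by simp [h])
    · exact h ((blockCycle_mem_letterBlock_iff hi).2 hyi)
  · rwa [blockCycle_apply_of_notMem hyi]

end BlockCycle

/-! ### Counting the fixed subsets -/

section Count

/-- Such an `A` is uniquely a union of blocks, indexed by some `J`, and a set `D` of letters beyond
the blocks and different from `f`. The condition `c * p ≤ b` is needed because truncated subtraction
would otherwise produce spurious terms. -/
theorem card_unions_of_letterBlocks {p n s b : ℕ} [Fact p.Prime] (hs : s * p ≤ n) {f : Fin n}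
    (hf : s * p ≤ f.val) :
    ((Finset.powersetCard b (Finset.univ.erase f)).filter fun A =>
        ∀ i : Fin s, ((A.filter (· ∈ letterBlock p n i)).card : ZMod p) = 0).card =
      ∑ c ∈ Finset.range (s + 1) with c * p ≤ b,
        s.choose c * (n - s * p - 1).choose (b - c * p) := by
  classical
  have hp : 0 < p := (Fact.out : p.Prime).pos
  have hi : ∀ i : Fin s, (i.val + 1) * p ≤ n := fun i =>
    (Nat.mul_le_mul_right p i.2).trans hs
  have hlt : ∀ (i : Fin s) m, m ∈ letterBlock p n i → m.val < s * p := fun i m hm =>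
    (mem_letterBlock.1 hm).2.trans_le (Nat.mul_le_mul_right p i.2)
  have hex : ∀ m : Fin n, m.val < s * p → ∃ i : Fin s, m ∈ letterBlock p n i := fun m hm => by
    refine ⟨⟨m.val / p, Nat.div_lt_of_lt_mul (by rwa [mul_comm])⟩, ?_⟩
    rw [mem_letterBlock]
    refine ⟨Nat.div_mul_le_self _ _, ?_⟩
    rw [mul_comm]
    exact Nat.lt_mul_div_succ _ hp
  set F : Finset (Fin n) := Finset.univ.filter fun m => s * p ≤ m.val ∧ m ≠ f with hF
  have hFcard : F.card = n - s * p - 1 := by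
    have h1 : F = (Finset.univ.filter fun m : Fin n => s * p ≤ m.val).erase f := by
      ext m; simp [hF, and_comm]
    rw [h1, Finset.card_erase_of_mem (by simpa using hf)]
    congr 1
    have h2 := Finset.card_filter_add_card_filter_not (s := (Finset.univ : Finset (Fin n)))
      (fun m => m.val < s * p)
    rw [Finset.card_univ, Fintype.card_fin, Fin.card_filter_val_lt] at h2
    simp only [not_lt] at h2
    omega
  set U : Finset (Fin s) → Finset (Fin n) := fun J => J.biUnion fun i => letterBlock p n i with hU
  have hUmem : ∀ J m, m ∈ U J ↔ ∃ i ∈ J, m ∈ letterBlock p n i := fun J m => by simp [hU]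
  have hUcard : ∀ J, (U J).card = J.card * p := fun J => by
    rw [hU, Finset.card_biUnion, Finset.sum_congr rfl fun i _ => card_letterBlock (hi i),
      Finset.sum_const, smul_eq_mul]
    intro i _ j _ hij
    exact Finset.disjoint_left.2 fun m h1 h2 => hij (Fin.ext (eq_of_mem_letterBlock h1 h2))
  have hdisj : ∀ J D, D ⊆ F → Disjoint (U J) D := fun J D hD => by
    rw [Finset.disjoint_left]
    intro m h1 h2
    obtain ⟨i, -, h⟩ := (hUmem J m).1 h1
    have := (Finset.mem_filter.1 (hD h2)).2.1
    have := hlt i m h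
    omega
  have hsum : ∑ c ∈ Finset.range (s + 1) with c * p ≤ b,
        s.choose c * (n - s * p - 1).choose (b - c * p) =
      (((Finset.univ : Finset (Finset (Fin s))).filter fun J => J.card * p ≤ b).sigma
        fun J => Finset.powersetCard (b - J.card * p) F).card := by
    rw [Finset.card_sigma]
    simp only [Finset.card_powersetCard, hFcard]
    rw [Finset.sum_filter, Finset.sum_filter, ← Finset.powerset_univ,
      Finset.sum_powerset_apply_card
        (fun c => if c * p ≤ b then (n - s * p - 1).choose (b - c * p) else 0),
      Finset.card_univ, Fintype.card_fin]
    refine Finset.sum_congr rfl fun c _ => ?_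
    split_ifs <;> simp
  rw [hsum]
  symm
  refine Finset.card_bij (fun x _ => U x.1 ∪ x.2) ?_ ?_ ?_
  · rintro ⟨J, D⟩ h
    simp only [Finset.mem_sigma, Finset.mem_filter, Finset.mem_univ, true_and,
      Finset.mem_powersetCard] at h
    obtain ⟨hJ, hD, hDc⟩ := h
    rw [Finset.mem_filter, Finset.mem_powersetCard]
    refine ⟨⟨fun m hm => Finset.mem_erase.2 ⟨?_, Finset.mem_univ _⟩, ?_⟩, fun i => ?_⟩
    · rintro rfl
      rcases Finset.mem_union.1 hm with h | h
      · obtain ⟨i, -, h⟩ := (hUmem J m).1 h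
        have := hlt i m h
        omega
      · exact (Finset.mem_filter.1 (hD h)).2.2 rfl
    · rw [Finset.card_union_of_disjoint (hdisj J D hD), hUcard, hDc]
      exact Nat.add_sub_cancel' hJ
    · rw [filter_letterBlock_eq_empty_or_subset (hi i)]
      by_cases hiJ : i ∈ J
      · right
        exact fun m hm => Finset.mem_union_left _ ((hUmem J m).2 ⟨i, hiJ, hm⟩)
      · left
        rw [Finset.filter_eq_empty_iff]
        intro m hm hmi
        rcases Finset.mem_union.1 hm with h | h
        · obtain ⟨j, hj, h⟩ := (hUmem J m).1 h
          exact hiJ (Fin.ext (eq_of_mem_letterBlock hmi h) ▸ hj)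
        · have := (Finset.mem_filter.1 (hD h)).2.1
          have := hlt i m hmi
          omega
  · rintro ⟨J, D⟩ h ⟨J', D'⟩ h' heq
    simp only [Finset.mem_sigma, Finset.mem_filter, Finset.mem_univ, true_and,
      Finset.mem_powersetCard] at h h' heq
    have hD : ∀ J D, D ⊆ F → (U J ∪ D).filter (s * p ≤ ·.val) = D := fun J D hD => by
      ext m
      rw [Finset.mem_filter, Finset.mem_union]
      constructor
      · rintro ⟨h | h, hm⟩
        · obtain ⟨i, -, h⟩ := (hUmem J m).1 h
          have := hlt i m h
          omega
        · exact h
      · exact fun h => ⟨Or.inr h, (Finset.mem_filter.1 (hD h)).2.1⟩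
    -- `J` is recovered by testing the first letter of each block.
    have hJ : ∀ J D, D ⊆ F → ∀ i : Fin s,
        blockLetter (hi i) ⟨0, hp⟩ ∈ U J ∪ D ↔ i ∈ J := fun J D hD i => by
      have hmi : blockLetter (hi i) ⟨0, hp⟩ ∈ letterBlock p n i :=
        (mem_letterBlock_iff_exists (hi i)).2 ⟨_, rfl⟩
      rw [Finset.mem_union]
      constructor
      · rintro (h | h)
        · obtain ⟨j, hj, h⟩ := (hUmem J _).1 h
          exact Fin.ext (eq_of_mem_letterBlock hmi h) ▸ hj
        · have := (Finset.mem_filter.1 (hD h)).2.1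
          have := hlt i _ hmi
          omega
      · exact fun h => Or.inl ((hUmem J _).2 ⟨i, h, hmi⟩)
    have h1 : D = D' := by rw [← hD J D h.2.1, heq, hD J' D' h'.2.1]
    have h2 : J = J' := by
      ext i
      rw [← hJ J D h.2.1, heq, hJ J' D' h'.2.1]
    rw [h1, h2]
  · intro A hA
    rw [Finset.mem_filter, Finset.mem_powersetCard] at hA
    obtain ⟨⟨hAf, hAb⟩, hA⟩ := hA
    set J : Finset (Fin s) := Finset.univ.filter fun i => letterBlock p n i ⊆ A with hJ
    have hunion : U J ∪ A.filter (s * p ≤ ·.val) = A := by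
      ext m
      rw [Finset.mem_union, Finset.mem_filter, hUmem]
      constructor
      · rintro (⟨i, hiJ, hm⟩ | h)
        · exact (Finset.mem_filter.1 hiJ).2 hm
        · exact h.1
      · intro hm
        by_cases hms : s * p ≤ m.val
        · exact Or.inr ⟨hm, hms⟩
        · left
          obtain ⟨i, hmi⟩ := hex m (not_le.1 hms)
          refine ⟨i, Finset.mem_filter.2 ⟨Finset.mem_univ _, ?_⟩, hmi⟩
          refine ((filter_letterBlock_eq_empty_or_subset (hi i)).1 (hA i)).resolve_left fun h => ?_
          exact absurd (Finset.mem_filter.2 ⟨hm, hmi⟩) (by simp [h])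
    have hDF : A.filter (s * p ≤ ·.val) ⊆ F := fun m hm => by
      rw [Finset.mem_filter] at hm
      exact Finset.mem_filter.2 ⟨Finset.mem_univ _, hm.2, (Finset.mem_erase.1 (hAf hm.1)).1⟩
    have hc := Finset.card_union_of_disjoint (hdisj J _ hDF)
    rw [hunion, hAb, hUcard] at hc
    refine ⟨⟨J, A.filter (s * p ≤ ·.val)⟩, ?_, hunion⟩
    simp only [Finset.mem_sigma, Finset.mem_filter, Finset.mem_univ, true_and,
      Finset.mem_powersetCard]
    exact ⟨by omega, hDF, by omega⟩

/-- The bound `c * p ≤ b` amounts to `c ≤ v`. The terms with `s - c > u`, absent from `lambdaPairs`,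
vanish: then `(s - c) * p > a`, so the lower entry of the second binomial exceeds the upper one. -/
theorem sum_lambdaPairs_eq {p a b d r u v a₀ b₀ s : ℕ}
    (hn : a + b = d * p + r) (hau : a = u * p + a₀) (hbv : b = v * p + b₀)
    (ha₀ : a₀ < p) (hb₀ : b₀ < p) (hsd : s ≤ d) :
    ∑ c ∈ Finset.range (s + 1) with c * p ≤ b,
        s.choose c * (a + b - s * p - 1).choose (b - c * p) =
      ∑ c ∈ lambdaPairs u v s, s.choose c.2 * ((d - s) * p + r - 1).choose (b - c.2 * p) := by
  have hsub : a + b - s * p - 1 = (d - s) * p + r - 1 := by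
    rw [hn, Nat.sub_mul]
    have := Nat.mul_le_mul_right p hsd
    omega
  rw [hsub]
  have hv : ∀ c, c * p ≤ b ↔ c ≤ v := fun c => by
    constructor
    · intro h
      by_contra! hc
      have := Nat.mul_le_mul_right p (Nat.succ_le_of_lt hc)
      rw [Nat.succ_mul] at this
      omega
    · intro h
      have := Nat.mul_le_mul_right p h
      omega
  symm
  refine Finset.sum_of_injOn Prod.snd ?_ ?_ ?_ fun _ _ => rfl
  · rintro ⟨c, c'⟩ h ⟨e, e'⟩ h' heq
    simp only [lambdaPairs, Finset.coe_filter, Finset.mem_product, Set.mem_ofPred_eq] at h h' heq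
    ext <;> simp only <;> omega
  · rintro ⟨c, c'⟩ h
    simp only [lambdaPairs, Finset.coe_filter, Finset.mem_product, Finset.mem_range,
      Set.mem_ofPred_eq, hv] at h ⊢
    omega
  · intro c hc hcn
    simp only [Finset.mem_filter, Finset.mem_range, hv] at hc
    have hcu : u < s - c := by
      by_contra! h
      refine hcn ⟨(s - c, c), ?_, rfl⟩
      simp only [lambdaPairs, Finset.coe_filter, Finset.mem_product, Finset.mem_range,
        Set.mem_ofPred_eq]
      omega
    refine mul_eq_zero_of_right _ (Nat.choose_eq_zero_of_lt ?_)
    have h1 := Nat.mul_le_mul_right p (Nat.succ_le_of_lt hcu)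
    rw [Nat.succ_mul, Nat.sub_mul] at h1
    have h2 := (hv c).2 hc.2
    have h3 : c * p ≤ s * p := Nat.mul_le_mul_right p (by omega)
    have h4 := Nat.mul_le_mul_right p hsd
    rw [← hsub]
    omega

end Count

/-! ### The main theorem -/

theorem asAlgebraHom_shiftedUnit_sub_one {k E V : Type*} [Field k] [Group E] [AddCommGroup V]
    [Module k V] {s : ℕ} (g : Fin s → E) (ρ : Representation k E V) (α : Fin s → k) :
    ρ.asAlgebraHom (shiftedUnit g α - 1) = ∑ i, α i • (ρ (g i) - 1) := by
  rw [shiftedUnit, add_sub_cancel_left, map_sum]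
  refine Finset.sum_congr rfl fun i _ => ?_
  rw [map_smul, map_sub, map_one, Representation.asAlgebraHom_of]

theorem exists_perm_powersetCard_map {Ω : Type*} [DecidableEq Ω] [Fintype Ω] (b : ℕ) {f : Ω}
    {σ : Equiv.Perm Ω} (hσ : σ f = f) :
    ∃ act : Equiv.Perm (Finset.powersetCard b (Finset.univ.erase f)),
      ∀ A, (act A).1 = A.1.map σ.toEmbedding := by
  have hmem : ∀ A : Finset.powersetCard b (Finset.univ.erase f),
      A.1.map σ.toEmbedding ∈ Finset.powersetCard b (Finset.univ.erase f) := by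
    rintro ⟨A, hA⟩
    rw [Finset.mem_powersetCard] at hA ⊢
    refine ⟨fun m hm => ?_, by rw [Finset.card_map, hA.2]⟩
    obtain ⟨x, hx, rfl⟩ := Finset.mem_map.1 hm
    refine Finset.mem_erase.2 ⟨fun h => ?_, Finset.mem_univ _⟩
    have hxf : x = f := σ.injective (h.trans hσ.symm)
    exact (Finset.mem_erase.1 (hA.1 hx)).1 hxf
  refine ⟨Equiv.ofBijective (fun A => ⟨_, hmem A⟩) (Finite.injective_iff_bijective.1 ?_),
    fun A => rfl⟩
  intro A B h
  exact Subtype.ext (Finset.map_injective _ (congrArg Subtype.val h))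

theorem mainTheorem4 {k : Type*} [Field k] [IsAlgClosed k] (p : ℕ) [Fact p.Prime] [CharP k p]
    (a b d r u v a₀ b₀ : ℕ) (ha : 1 ≤ a)
    (hn : a + b = d * p + r) (hau : a = u * p + a₀) (hbv : b = v * p + b₀)
    (hr : r < p) (ha₀ : a₀ < p) (hb₀ : b₀ < p) (hr0 : r ≠ 0)
    (s : ℕ) (hs1 : 1 ≤ s) (hsd : s ≤ d) :
    HasStableGenericJordanType p (elemAbelianGen p (a + b) s)
      ((spechtRep k (hookDiagram a b ha) (a + b)).comp (elemAbelian p (a + b) s).subtype)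
      (Multiset.replicate
        (∑ c ∈ lambdaPairs u v s,
          Nat.choose s c.2 * Nat.choose ((d - s) * p + r - 1) (b - c.2 * p)) 1) := by
  classical
  have hp : 1 < p := (Fact.out : p.Prime).one_lt
  have hsp : s * p < a + b := by
    have := Nat.mul_le_mul_right p hsd
    omega
  have hi : ∀ i : Fin s, (i.val + 1) * p ≤ a + b := fun i =>
    (Nat.mul_le_mul_right p i.2).trans hsp.le
  -- The first letter after the `s` blocks; it exists because `s * p ≤ d * p < a + b`, by `r ≠ 0`.
  let f : Fin (a + b) := ⟨s * p, hsp⟩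
  have hf : ∀ i : Fin s, blockCycle p (a + b) i f = f := fun i =>
    blockCycle_apply_of_notMem fun h =>
      absurd ((mem_letterBlock.1 h).2.trans_le (Nat.mul_le_mul_right p i.2)) (lt_irrefl _)
  obtain ⟨e, he⟩ := exists_basis_spechtModule_hook k ha f
  choose act hact using fun i : Fin s => exists_perm_powersetCard_map b (hf i)
  obtain ⟨M, hM⟩ := exists_hasJordanType_of_signed_permutation p hs1 e
    (fun i => spechtRep k (hookDiagram a b ha) (a + b) (blockCycle p (a + b) i))
    (fun i j => (commute_blockCycle i.val j.val).map _)
    (fun i => by rw [← map_pow, blockCycle_pow (hi i), map_one]) act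
    (fun i A => he _ (hf i) A _ (hact i A))
    -- `size` counts the letters of `A` in block `i`, and `pos` adds them up, both mod `p`; `g_i`
    -- raises each such letter by 1 mod `p`, hence `pos` by `size`.
    (fun A i => ((A.1.filter (· ∈ letterBlock p (a + b) i)).card : ZMod p))
    (fun A i => ∑ m ∈ A.1 with m ∈ letterBlock p (a + b) i, (m.val : ZMod p))
    (fun i A => by
      funext j
      rw [hact, Finset.card_eq_sum_ones, sum_filter_map_blockCycle (hi i),
        ← Finset.card_eq_sum_ones])
    (fun i A => by
      rw [hact, sum_filter_map_blockCycle (hi i), Finset.card_eq_sum_ones, Nat.cast_sum,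
        ← Finset.sum_add_distrib]
      refine Finset.sum_congr rfl fun m hm => ?_
      rw [cast_blockCycle (hi i) (Finset.mem_filter.1 hm).2, Nat.cast_one])
    (fun i j A hij => by
      rw [hact, sum_filter_map_blockCycle (hi i)]
      refine Finset.sum_congr rfl fun m hm => ?_
      rw [blockCycle_apply_of_notMem fun h =>
        hij (Fin.ext (eq_of_mem_letterBlock (Finset.mem_filter.1 hm).2 h))])
    (fun i A h => Subtype.ext (by rw [hact, map_blockCycle_eq_self (hi i) h]))
  have hcount : Nat.card {A : Finset.powersetCard b (Finset.univ.erase f) //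
      (fun i : Fin s => ((A.1.filter (· ∈ letterBlock p (a + b) i)).card : ZMod p)) = 0} =
      ∑ c ∈ lambdaPairs u v s,
        Nat.choose s c.2 * Nat.choose ((d - s) * p + r - 1) (b - c.2 * p) := by
    rw [← sum_lambdaPairs_eq hn hau hbv ha₀ hb₀ hsd,
      ← card_unions_of_letterBlocks hsp.le (f := f) le_rfl, Nat.card_eq_fintype_card,
      Fintype.card_subtype, ← Finset.card_map (Function.Embedding.subtype _)]
    congr 1
    ext A
    simp only [Finset.mem_map, Finset.mem_filter, Finset.mem_univ, true_and, funext_iff,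
      Function.Embedding.subtype_apply, Pi.zero_apply]
    constructor
    · rintro ⟨B, hB, rfl⟩
      exact ⟨B.2, hB⟩
    · rintro ⟨h1, h2⟩
      exact ⟨⟨A, h1⟩, h2, rfl⟩
  rw [hcount] at hM
  -- The open set is where the product of the coordinates is nonzero, that is, where all `α i ≠ 0`.
  refine ⟨Multiset.replicate (∑ c ∈ lambdaPairs u v s,
      Nat.choose s c.2 * Nat.choose ((d - s) * p + r - 1) (b - c.2 * p)) 1 +
      Multiset.replicate M p, ⟨∏ i, MvPolynomial.X i, ?_, fun α hα => ?_⟩, ?_⟩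
  · exact Finset.prod_ne_zero_iff.2 fun i _ => MvPolynomial.X_ne_zero i
  · rw [asAlgebraHom_shiftedUnit_sub_one]
    refine hM α fun i => ?_
    simp only [map_prod, MvPolynomial.eval_X] at hα
    exact Finset.prod_ne_zero_iff.1 hα i (Finset.mem_univ i)
  · rw [Multiset.filter_add, Multiset.filter_eq_self.2, Multiset.filter_eq_nil.2, add_zero]
    · intro x hx
      simpa using Multiset.eq_of_mem_replicate hx
    · intro x hx
      rw [Multiset.eq_of_mem_replicate hx]
      exact hp.ne
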